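/- Let $(K,<)$ be a (totally) ordered field. For $g,r\in K$ with $r\ge 0$ let $B_o(g;r)=\{z\in K : |g-z|\le r\}$. A nest of order balls is a nonempty collection of sets of this form that is totally ordered by inclusion. The order ball space of $K$ is called spherically complete if every nest of order balls has a nonempty intersection. Let $v$ be the natural valuation of $(K,<)$: $v(x)$ is the archimedean equivalence class of $x$, where $x,y$ are equivalent if $|x|\le n|y|$ and $|y|\le n|x|$ for some $n\in\mathbb N$. Here the classes are written additively, with $v(x)+v(y)=v(xy)$, larger absolute values having smaller value; let $\Gamma=v(K^{\times})$ be the value group. For an ordered abelian group $\Gamma$, let $\mathbb R((\Gamma))$ denote the power series field with exponents in $\Gamma$ and coefficients in $\mathbb R$, that is, the field of all formal series $\sum_{\gamma\in\Gamma}a_\gamma t^\gamma$ with $a_\gamma\in\mathbb R$ and well-ordered support, ordered by declaring a nonzero series positive if and only if its leading coefficient (the one at the least exponent of its support) is positive. **Theorem.** If the order ball space of the ordered field $K$ is spherically complete, then the residue field of $K$ under its natural valuation is isomorphic to $\mathbb R$ as an ordered field, and $K$ is isomorphic, as an ordered field, to the power series field $\mathbb R((\Gamma))$ over its own value group $\Gamma$.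 The isomorphism can be chosen such that for every $x\in K^{\times}$ the least exponent in the support of the image of $x$ is $v(x)$. -/

import Mathlib

/-- A ball space on `X`: a nonempty collection of nonempty subsets of `X`, called balls. -/
structure BallSpace (X : Type*) where
  balls : Set (Set X)
  nonempty_balls : balls.Nonempty
  nonempty_of_mem : ∀ B ∈ balls, B.Nonempty

namespace BallSpace

/-- A nest of balls: a nonempty collection of balls that is totally ordered by inclusion. -/
def IsNest {X : Type*} (S : BallSpace X) (N : Set (Set X)) : Prop :=
  N ⊆ S.balls ∧ N.Nonempty ∧ IsChain (· ⊆ ·) N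

/-- Every nest of balls has a nonempty intersection. -/
def SphericallyComplete {X : Type*} (S : BallSpace X) : Prop :=
  ∀ N : Set (Set X), S.IsNest N → (⋂₀ N).Nonempty

end BallSpace

/-- The order ball `{z ∈ G | |g - z| ≤ r}`. -/
def orderBall {G : Type*} [AddCommGroup G] [LinearOrder G] (g r : G) : Set G :=
  {z : G | |g - z| ≤ r}

/-- The order ball space of an ordered abelian group: all order balls of radius `r ≥ 0`. -/
def orderBallSpace (G : Type*) [AddCommGroup G] [LinearOrder G] [IsOrderedAddMonoid G] :
    BallSpace G where
  balls := {B : Set G | ∃ g r : G, 0 ≤ r ∧ B = orderBall g r}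
  nonempty_balls := ⟨orderBall 0 0, 0, 0, le_refl 0, rfl⟩
  nonempty_of_mem := by
    rintro B ⟨g, r, hr, rfl⟩
    exact ⟨g, by simpa [orderBall] using hr⟩

/-- The value group of the natural valuation `ArchimedeanClass.mk` of an ordered field, written
additively. The elements of `ArchimedeanClass K` other than `⊤ = ArchimedeanClass.mk 0` are
precisely the (additively) invertible ones, and larger absolute values have smaller class. -/
abbrev NaturalValueGroup (K : Type*) [Field K] [LinearOrder K] [IsStrictOrderedRing K] : Type _ :=
  AddUnits (ArchimedeanClass K)

/-- The field `k((Γ))` of formal power series with well-ordered support, ordered by the sign of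
the leading coefficient (equivalently, lexicographically). -/
abbrev PowerSeriesField (Γ k : Type*) [AddCommGroup Γ] [LinearOrder Γ] [IsOrderedAddMonoid Γ]
    [Field k] [LinearOrder k] [IsStrictOrderedRing k] : Type _ :=
  Lex (HahnSeries Γ k)

/-! Spherical completeness of the order balls enters only through three consequences, collected in
`IsMaximallyValued`: pairwise meeting ultrametric balls of the natural valuation have a common
point, every real number is realized by an element of K up to rational comparison, and the value
group is divisible. The second gives the residue field. The power series field over a divisible Γ
has the same three properties, so the theorem becomes a uniqueness statement for such fields, proved
by extending a partial isomorphism.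

The three properties already imply real closedness, in the form of `PolynomialIVT`. After
translation to a suitable centre, every cut separates archimedean classes
(`IsMaximallyValued.exists_isCutCenter`). Close to such a cut one Taylor monomial dominates all the
others, so a polynomial cannot change sign across the cut. Roots of positive elements then make the
positive units a divisible, hence injective, group, and the value group lifts to a group of positive
elements s(γ) (`PolynomialIVT.exists_crossSection`).

The assignment s(γ) ↦ t^γ generates an order isomorphism of subrings of the two fields, because a
finite integer combination has the sign of its dominant term. By Zorn it lies in a maximal one, R.
Maximality puts all roots of polynomials over R into R (`IsMaximalPartialIso.rootsMem`). For any
other x, the cut of x over R therefore fixes the sign of every polynomial at x, and any y in the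
corresponding cut extends R. Such a y exists by intersecting balls if x has no best approximation in
R, and by realizing a real number otherwise (`IsMaximalPartialIso.exists_sameCut`). So R is total,
in both directions by symmetry, and it preserves values because it matches s(γ) with t^γ. -/

set_option linter.unusedSectionVars false

open ArchimedeanClass Polynomial

/-- An ordered field which is spherically complete for its natural valuation, with residue
field `ℝ` and divisible value group. -/
structure IsMaximallyValued (K : Type*) [Field K] [LinearOrder K] [IsStrictOrderedRing K] :
    Prop where
  intro ::
  exists_center : ∀ S : Set (K × K),
    (∀ p ∈ S, ∀ q ∈ S, min (mk p.2) (mk q.2) ≤ mk (p.1 - q.1)) →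
      ∃ x, ∀ p ∈ S, mk p.2 ≤ mk (x - p.1)
  exists_real : ∀ r : ℝ, ∃ x : K, ∀ q : ℚ, ((q : ℝ) < r → (q : K) < x) ∧ (r < q → x < q)
  exists_mk_pow : ∀ n : ℕ, n ≠ 0 → ∀ c : K, ∃ t, mk (t ^ n) = mk c

/-- The intermediate value property for polynomials. -/
def PolynomialIVT (K : Type*) [Field K] [LinearOrder K] : Prop :=
  ∀ (f : K[X]) (a b : K), a < b → f.eval a < 0 → 0 < f.eval b → ∃ c, a < c ∧ c < b ∧ f.eval c = 0

/-! ### Cuts in maximally valued fields and the intermediate value property -/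

section Cut

variable {K : Type*} [Field K] [LinearOrder K] [IsStrictOrderedRing K]

/-- The property `P` holds between some point of the lower set `A` and some point of its
complement, in coordinates centered at `x`. -/
def NearCut (A : Set K) (x : K) (P : K → Prop) : Prop :=
  ∃ u v, 0 ≤ u ∧ x + u ∈ A ∧ x + v ∉ A ∧ ∀ y, u ≤ y → y ≤ v → P y

/-- `x` is a point of the lower set `A` from which the cut is seen as a cut between
archimedean classes. -/
def IsCutCenter (A : Set K) (x : K) : Prop :=
  x ∈ A ∧ ∀ a ∈ A, ∀ b ∉ A, ∀ n : ℕ, n * (a - x) < b - x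

theorem NearCut.and {A : Set K} {x : K} {P Q : K → Prop} (hP : NearCut A x P)
    (hQ : NearCut A x Q) : NearCut A x fun y ↦ P y ∧ Q y := by
  obtain ⟨u, v, hu, hua, hva, h⟩ := hP
  obtain ⟨u', v', hu', hua', hva', h'⟩ := hQ
  refine ⟨max u u', min v v', le_max_of_le_left hu, ?_, ?_, fun y h1 h2 ↦ ⟨?_, ?_⟩⟩
  · rcases max_choice u u' with h | h <;> rwa [h]
  · rcases min_choice v v' with h | h <;> rwa [h]
  · exact h y ((le_max_left _ _).trans h1) (h2.trans (min_le_left _ _))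
  · exact h' y ((le_max_right _ _).trans h1) (h2.trans (min_le_right _ _))

theorem NearCut.finset {ι : Type*} {A : Set K} {x : K} (hx : x ∈ A) (hA : Aᶜ.Nonempty)
    (s : Finset ι) {P : ι → K → Prop} (h : ∀ i ∈ s, NearCut A x (P i)) :
    NearCut A x fun y ↦ ∀ i ∈ s, P i y := by
  classical
  induction s using Finset.induction_on with
  | empty =>
    obtain ⟨b, hb⟩ := hA
    exact ⟨0, b - x, le_rfl, by simpa, by simpa using hb, by simp⟩
  | insert i s _ ih =>
    simp only [Finset.mem_insert, forall_eq_or_imp] at h ⊢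
    exact h.1.and (ih h.2)

theorem IsCutCenter.add_mul_mem {A : Set K} {x t : K} (h : IsCutCenter A x) (ht : x + t ∈ A)
    (n : ℕ) : x + n * t ∈ A := by
  by_contra hn
  simpa using h.2 _ ht _ hn n

theorem IsCutCenter.add_div_notMem {A : Set K} {x t : K} (h : IsCutCenter A x)
    (ht : x + t ∉ A) {n : ℕ} (hn : n ≠ 0) : x + t / n ∉ A := by
  intro hm
  have := h.2 _ hm _ ht n
  have hn' : (n : K) ≠ 0 := by exact_mod_cast hn
  simp [mul_div_cancel₀ _ hn'] at this

theorem exists_abs_le_of_mk_le {a b : K} (h : mk a ≤ mk b) : ∃ n : ℕ, |b| ≤ n * |a| := by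
  obtain ⟨n, hn⟩ := mk_le_mk.1 h
  exact ⟨n, by simpa using hn⟩

theorem mk_le_of_abs_le {a b : K} (n : ℕ) (h : |b| ≤ n * |a|) : mk a ≤ mk b :=
  mk_le_mk.2 ⟨n, by simpa using h⟩

/-- The two monomials are comparable only for y of the class of t, where t ^ (j - i) has the class
of c / d. The cut at a centre does not split an archimedean class, so t lies on one side of it
together with all its multiples or fractions, which leaves room for the arbitrary factor `N`. -/
theorem IsCutCenter.dominates {A : Set K} {x : K} (h : IsCutCenter A x) (hA : Aᶜ.Nonempty)
    (hroot : ∀ n : ℕ, n ≠ 0 → ∀ c : K, ∃ t, mk (t ^ n) = mk c) (N : ℕ) (c d : K) {i j : ℕ}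
    (hij : i < j) :
    NearCut A x (fun y ↦ N * |d * y ^ j| ≤ |c * y ^ i|) ∨
      NearCut A x (fun y ↦ N * |c * y ^ i| ≤ |d * y ^ j|) := by
  obtain ⟨b, hb⟩ := hA
  obtain ⟨k, rfl⟩ := Nat.exists_eq_add_of_lt hij
  rcases eq_or_ne d 0 with rfl | hd
  · exact .inl ⟨0, b - x, le_rfl, by simpa using h.1, by simpa using hb,
      fun y _ _ ↦ by simp only [zero_mul, abs_zero, mul_zero]; positivity⟩
  obtain ⟨t, ht⟩ := hroot (k + 1) (by simp) (c / d)
  have ht' : mk (d * |t| ^ (k + 1)) = mk c := by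
    have hc : c = d * (c / d) := by field_simp
    rw [hc, mk_mul, mk_mul, ← ht, ← abs_pow, mk_abs]
  have key (M : ℕ) (hM : M ≠ 0) : (M : K) ≤ M ^ (k + 1) := by
    exact_mod_cast Nat.le_self_pow (by simp) M
  by_cases hta : x + |t| ∈ A
  · right
    obtain ⟨m, hm⟩ := exists_abs_le_of_mk_le ht'.le
    refine ⟨(N * m + 1 : ℕ) * |t|, b - x, by positivity, h.add_mul_mem hta _, by simpa using hb,
      fun y hy _ ↦ ?_⟩
    have hy0 : 0 ≤ y := le_trans (by positivity) hy
    have h1 : (N : K) * |c| ≤ |d| * y ^ (k + 1) := by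
      calc (N : K) * |c| ≤ N * (m * |d * |t| ^ (k + 1)|) := by gcongr
        _ = (N * m : K) * (|d| * |t| ^ (k + 1)) := by simp [abs_mul]; ring
        _ ≤ ((N * m + 1 : ℕ) : K) * (|d| * |t| ^ (k + 1)) := by
          gcongr; push_cast; linarith
        _ ≤ ((N * m + 1 : ℕ) : K) ^ (k + 1) * (|d| * |t| ^ (k + 1)) := by
          gcongr; exact key _ (by simp)
        _ = |d| * (((N * m + 1 : ℕ) : K) * |t|) ^ (k + 1) := by ring
        _ ≤ |d| * y ^ (k + 1) := by gcongr
    calc (N : K) * |c * y ^ i| = (N * |c|) * y ^ i := by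
          rw [abs_mul, abs_of_nonneg (pow_nonneg hy0 i)]; ring
      _ ≤ (|d| * y ^ (k + 1)) * y ^ i := by gcongr
      _ = |d * y ^ (i + k + 1)| := by
          rw [abs_mul, abs_of_nonneg (pow_nonneg hy0 _)]; ring
  · left
    obtain ⟨m, hm⟩ := exists_abs_le_of_mk_le ht'.ge
    refine ⟨0, |t| / (N * m + 1 : ℕ), le_rfl, by simpa using h.1,
      h.add_div_notMem hta (by simp), fun y hy0 hy ↦ ?_⟩
    have h1 : (N : K) * (|d| * y ^ (k + 1)) ≤ |c| := by
      have hp : (0 : K) < ((N * m + 1 : ℕ) : K) := by positivity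
      rw [le_div_iff₀ hp] at hy
      have h2 : ((N * m + 1 : ℕ) : K) * (N * (|d| * y ^ (k + 1))) ≤ (N * m + 1 : ℕ) * |c| := by
        calc ((N * m + 1 : ℕ) : K) * (N * (|d| * y ^ (k + 1)))
            ≤ ((N * m + 1 : ℕ) : K) ^ (k + 1) * (N * (|d| * y ^ (k + 1))) := by
              gcongr; exact key _ (by simp)
          _ = N * (|d| * (y * (N * m + 1 : ℕ)) ^ (k + 1)) := by ring
          _ ≤ N * (|d| * |t| ^ (k + 1)) := by gcongr
          _ = N * |d * |t| ^ (k + 1)| := by simp [abs_mul]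
          _ ≤ N * (m * |c|) := by gcongr
          _ = (N * m : K) * |c| := by ring
          _ ≤ (N * m + 1 : ℕ) * |c| := by gcongr; push_cast; linarith
      exact le_of_mul_le_mul_left h2 hp
    calc (N : K) * |d * y ^ (i + k + 1)| = (N * (|d| * y ^ (k + 1))) * y ^ i := by
          rw [abs_mul, abs_of_nonneg (pow_nonneg hy0 _)]; ring
      _ ≤ |c| * y ^ i := by gcongr
      _ = |c * y ^ i| := by rw [abs_mul, abs_of_nonneg (pow_nonneg hy0 i)]

/-- Near the cut, each two monomials of the Taylor expansion at x are ordered by dominance. The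
strongest one decides the sign, and s is its coefficient since y ≥ 0. The factor d + 1 exceeds the
number of competing terms. -/
theorem IsCutCenter.eval_sign {A : Set K} {x : K} (h : IsCutCenter A x) (hA : Aᶜ.Nonempty)
    (hlow : IsLowerSet A) (hroot : ∀ n : ℕ, n ≠ 0 → ∀ c : K, ∃ t, mk (t ^ n) = mk c)
    (f : K[X]) : ∃ s, NearCut A x fun y ↦ f.eval (x + y) = 0 ∨ 0 < s * f.eval (x + y) := by
  set g := taylor x f with hg
  set d := g.natDegree + 1 with hd
  have heval (y : K) : f.eval (x + y) = ∑ i ∈ Finset.range d, g.coeff i * y ^ i := by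
    rw [add_comm, ← taylor_eval, eval_eq_sum_range]
  let D (p : ℕ × ℕ) (y : K) : Prop :=
    ((d + 1 : ℕ) : K) * |g.coeff p.2 * y ^ p.2| ≤ |g.coeff p.1 * y ^ p.1|
  have hD (i j : ℕ) (hij : i ≠ j) : NearCut A x (D (i, j)) ∨ NearCut A x (D (j, i)) := by
    rcases hij.lt_or_gt with hij | hij
    · exact h.dominates hA hroot (d + 1) _ _ hij
    · exact (h.dominates hA hroot (d + 1) _ _ hij).symm
  classical
  obtain ⟨u, v, hu, hua, hva, huv⟩ := NearCut.finset h.1 hA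
    ((Finset.range d ×ˢ Finset.range d).filter fun p ↦ NearCut A x (D p)) (P := D)
    fun p hp ↦ (Finset.mem_filter.1 hp).2
  have hlt : u < v := by
    by_contra! hvu
    exact hva (hlow (by simpa using hvu) hua)
  -- The monomial largest at the single point v dominates on the whole interval: if another one
  -- dominated it instead, comparison at v > 0 would force that other coefficient to vanish.
  obtain ⟨m, hm, hmax⟩ := Finset.exists_max_image (Finset.range d)
    (fun i ↦ |g.coeff i * v ^ i|) ⟨0, by simp [hd]⟩
  refine ⟨g.coeff m, u, v, hu, hua, hva, fun y h1 h2 ↦ ?_⟩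
  have hv : 0 < v := hu.trans_lt hlt
  have hy : 0 ≤ y := hu.trans h1
  have hdpos : (1 : K) < ((d + 1 : ℕ) : K) := by
    rw [hd]; push_cast; linarith [(Nat.cast_nonneg g.natDegree : (0 : K) ≤ _)]
  have hdom (j : ℕ) (hj : j ∈ Finset.range d) (hjm : j ≠ m) :
      ((d + 1 : ℕ) : K) * |g.coeff j * y ^ j| ≤ |g.coeff m * y ^ m| := by
    rcases hD m j hjm.symm with hmj | hmj
    · exact huv y h1 h2 (m, j) (by simp only [Finset.mem_filter, Finset.mem_product]; tauto)
    · have h3 : ((d + 1 : ℕ) : K) * |g.coeff m * v ^ m| ≤ |g.coeff j * v ^ j| :=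
        huv v hlt.le le_rfl (j, m) (by simp only [Finset.mem_filter, Finset.mem_product]; tauto)
      have h4 := hmax j hj
      have h5 : |g.coeff m * v ^ m| = 0 := by
        refine le_antisymm ?_ (abs_nonneg _)
        nlinarith [abs_nonneg (g.coeff m * v ^ m)]
      have h6 : |g.coeff j * v ^ j| = 0 := le_antisymm (h4.trans h5.le) (abs_nonneg _)
      have h7 : g.coeff j = 0 := by simpa [hv.ne'] using h6
      simp only [h7, zero_mul, abs_zero, mul_zero]; positivity
  beta_reduce
  rw [heval, ← Finset.add_sum_erase _ _ hm]
  set E := ∑ i ∈ (Finset.range d).erase m, g.coeff i * y ^ i with hE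
  have hEle : ((d + 1 : ℕ) : K) * |E| ≤ d * |g.coeff m * y ^ m| := by
    calc ((d + 1 : ℕ) : K) * |E|
        ≤ (d + 1 : ℕ) * ∑ i ∈ (Finset.range d).erase m, |g.coeff i * y ^ i| := by
          gcongr; exact Finset.abs_sum_le_sum_abs _ _
      _ = ∑ i ∈ (Finset.range d).erase m, (d + 1 : ℕ) * |g.coeff i * y ^ i| := Finset.mul_sum ..
      _ ≤ ∑ i ∈ (Finset.range d).erase m, |g.coeff m * y ^ m| := by
          refine Finset.sum_le_sum fun i hi ↦ ?_
          rw [Finset.mem_erase] at hi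
          exact hdom i hi.2 hi.1
      _ = ((Finset.range d).erase m).card * |g.coeff m * y ^ m| := by simp
      _ ≤ d * |g.coeff m * y ^ m| := by
          gcongr
          simpa using Finset.card_le_card (Finset.erase_subset m (Finset.range d))
  by_cases h0 : g.coeff m * y ^ m = 0
  · left
    rw [h0] at hEle ⊢
    have : |E| ≤ 0 := by
      by_contra! hlt
      simp only [abs_zero, mul_zero] at hEle
      nlinarith
    simpa using this
  · right
    have hpos : 0 < |g.coeff m * y ^ m| := abs_pos.2 h0
    have hElt : |E| < |g.coeff m * y ^ m| := by
      by_contra! hle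
      push_cast at hEle
      have : (0 : K) ≤ d := Nat.cast_nonneg d
      nlinarith
    have hc : g.coeff m ≠ 0 := fun hc ↦ h0 (by simp [hc])
    have hym : 0 < y ^ m := (pow_nonneg hy m).lt_of_ne' fun hc ↦ h0 (by simp [hc])
    rcases hc.lt_or_gt with hc | hc
    · have : g.coeff m * y ^ m < 0 := mul_neg_of_neg_of_pos hc hym
      rw [abs_of_neg this] at hElt
      exact mul_pos_of_neg_of_neg hc (by linarith [le_abs_self E])
    · have : 0 < g.coeff m * y ^ m := mul_pos hc hym
      rw [abs_of_pos this] at hElt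
      exact mul_pos hc (by linarith [neg_abs_le E])

/-- The mirror image of a cut. -/
def mirrorCut (A : Set K) : Set K := {z | -z ∉ A}

/-- If x fails to be a centre, the cut lies at a positive real multiple r of some c beyond x.
Correcting x to z = x + ρc, with ρ realizing r, leaves only discrepancies infinitesimal relative to
c. If z failed as well, some point across the cut would be infinitesimally close to z relative to c,
whereas `hball` keeps their distance at least of the order of c. -/
theorem IsMaximallyValued.exists_isCutCenter_of_mem (h : IsMaximallyValued K) {A : Set K}
    (hlow : IsLowerSet A) {x : K} (hx : x ∈ A)
    (hball : ∀ a ∈ A, ∀ b ∉ A, mk (b - a) ≤ mk (x - a)) :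
    ∃ z, IsCutCenter A z ∨ IsCutCenter (mirrorCut A) z := by
  by_cases hc : IsCutCenter A x
  · exact ⟨x, .inl hc⟩
  simp only [IsCutCenter, hx, true_and, not_forall, not_lt] at hc
  obtain ⟨a₁, ha₁, b₁, hb₁, n, hn⟩ := hc
  set c := b₁ - x with hcdef
  have hcpos : 0 < c := by
    rw [hcdef, sub_pos]
    by_contra! hle
    exact hb₁ (hlow hle hx)
  have hxa₁ : 0 < a₁ - x := by
    by_contra! hle
    have : (n : K) * (a₁ - x) ≤ 0 := mul_nonpos_of_nonneg_of_nonpos (by positivity) hle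
    linarith
  have hn0 : (0 : K) < n := by
    by_contra! hle
    have : (n : K) * (a₁ - x) ≤ 0 := mul_nonpos_of_nonpos_of_nonneg hle hxa₁.le
    linarith
  -- The position of the cut measured from x in units of c; its supremum is the real number r.
  let Q : Set ℝ := {r | ∃ q : ℚ, (q : ℝ) = r ∧ x + q * c ∈ A}
  have hQbdd : ∀ q : ℚ, x + q * c ∈ A → q ≤ 1 := by
    intro q hq
    by_contra! hlt
    refine hb₁ (hlow ?_ hq)
    have : (1 : K) < q := by exact_mod_cast hlt
    nlinarith
  have hQb : BddAbove Q := ⟨1, by rintro _ ⟨q, rfl, hq⟩; exact_mod_cast hQbdd q hq⟩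
  have hnQ : ((1 / n : ℚ) : ℝ) ∈ Q := by
    refine ⟨1 / n, rfl, hlow ?_ ha₁⟩
    have : (1 / n : K) * c ≤ a₁ - x := by
      rw [one_div, inv_mul_le_iff₀ hn0]; exact hn
    push_cast
    linarith
  set r := sSup Q with hr
  have hrpos : 0 < r := by
    refine lt_of_lt_of_le ?_ (le_csSup hQb hnQ)
    have : (0 : ℚ) < n := by exact_mod_cast hn0
    have h2 : (0 : ℚ) < 1 / n := by positivity
    exact_mod_cast h2
  have hbelow (q : ℚ) (hq : (q : ℝ) < r) : x + q * c ∈ A := by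
    obtain ⟨_, ⟨q', rfl, hq'⟩, hlt⟩ := exists_lt_of_lt_csSup ⟨_, hnQ⟩ hq
    refine hlow ?_ hq'
    have : (q : K) < q' := by exact_mod_cast hlt
    linarith [mul_lt_mul_of_pos_right this hcpos]
  have habove (q : ℚ) (hq : r < q) : x + q * c ∉ A := fun hm ↦
    hq.not_ge (le_csSup hQb ⟨q, rfl, hm⟩)
  obtain ⟨ρ, hρ⟩ := h.exists_real r
  set z := x + ρ * c with hz
  obtain ⟨q₀, hq₀, hq₀r⟩ := exists_rat_btwn hrpos
  have hq₀ρ : (q₀ : K) < ρ := (hρ q₀).1 hq₀r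
  have hq₀pos : (0 : ℚ) < q₀ := by exact_mod_cast hq₀
  -- elements of either side which lie beyond `z` are infinitesimally close to `z`
  have hup (a : K) (ha : a ∈ A) (ε : ℚ) (hε : 0 < ε) : a < z + ε * c := by
    obtain ⟨q, hq, hqr⟩ := exists_rat_btwn (show r < r + ε / 2 by
      have : (0 : ℝ) < ε := by exact_mod_cast hε
      linarith)
    have h1 : a < x + q * c := by
      by_contra! hle
      exact habove q hq (hlow hle ha)
    obtain ⟨q', hq'1, hq'2⟩ := exists_rat_btwn (show r - ε / 2 < r by
      have : (0 : ℝ) < ε := by exact_mod_cast hε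
      linarith)
    have h2 : (q' : K) < ρ := (hρ q').1 hq'2
    have h3 : q < q' + ε := by
      have : (q : ℝ) < q' + ε := by linarith
      exact_mod_cast this
    have h4 : (q : K) < q' + ε := by exact_mod_cast h3
    linarith [mul_lt_mul_of_pos_right h2 hcpos, mul_lt_mul_of_pos_right h4 hcpos]
  have hdown (b : K) (hb : b ∉ A) (ε : ℚ) (hε : 0 < ε) : z - ε * c < b := by
    obtain ⟨q, hqr, hq⟩ := exists_rat_btwn (show r - ε / 2 < r by
      have : (0 : ℝ) < ε := by exact_mod_cast hε
      linarith)
    have h1 : x + q * c < b := by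
      by_contra! hle
      exact hb (hlow hle (hbelow q hq))
    obtain ⟨q', hq'1, hq'2⟩ := exists_rat_btwn (show r < r + ε / 2 by
      have : (0 : ℝ) < ε := by exact_mod_cast hε
      linarith)
    have h2 : ρ < (q' : K) := (hρ q').2 hq'1
    have h3 : q' < q + ε := by
      have : (q' : ℝ) < q + ε := by linarith
      exact_mod_cast this
    have h4 : (q' : K) < q + ε := by exact_mod_cast h3
    linarith [mul_lt_mul_of_pos_right h2 hcpos, mul_lt_mul_of_pos_right h4 hcpos]
  have hclose (u : K) (hu : ∀ ε : ℚ, 0 < ε → |u| ≤ ε * c) (hle : mk u ≤ mk c) : False := by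
    obtain ⟨m, hm⟩ := exists_abs_le_of_mk_le hle
    have h1 := hu (1 / (m + 1)) (by positivity)
    rw [abs_of_pos hcpos] at hm
    have h2 : (m : K) * |u| ≤ m * (((1 / (m + 1) : ℚ) : K) * c) := by gcongr
    have h3 : (m : K) * (((1 / (m + 1) : ℚ) : K) * c) = c - c / (m + 1) := by
      have : (m : K) + 1 ≠ 0 := by positivity
      push_cast
      field_simp
      ring
    have h4 : (0 : K) < c / (m + 1) := by positivity
    linarith
  have hmkc (u : K) (hu : q₀ / 2 * c ≤ u - x) (hu' : u ≤ b₁) : mk (x - u) = mk c := by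
    have hq : (0 : K) < q₀ := by exact_mod_cast hq₀pos
    have hux : |x - u| = u - x := by
      rw [abs_sub_comm, abs_of_nonneg]
      exact le_trans (by positivity) hu
    refine le_antisymm ?_ (mk_le_of_abs_le 1 ?_)
    · refine mk_le_mk_iff_ratCast.2 ⟨q₀ / 2, by positivity, ?_⟩
      rw [hux, abs_of_pos hcpos]
      push_cast
      exact hu
    · rw [hux, abs_of_pos hcpos]
      simp only [Nat.cast_one, one_mul, hcdef]
      linarith
  have hqK : (0 : K) < q₀ := by exact_mod_cast hq₀pos
  have hhalf (b : K) (hb : z - (q₀ / 2 : ℚ) * c < b) : q₀ / 2 * c ≤ b - x := by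
    push_cast at hb
    linarith [mul_lt_mul_of_pos_right hq₀ρ hcpos]
  by_cases hzA : z ∈ A
  · refine ⟨z, .inl ⟨hzA, fun a ha b hb k ↦ ?_⟩⟩
    by_contra! hle
    have hbz : z < b := by
      by_contra! hlt
      exact hb (hlow hlt hzA)
    have hk : (0 : K) < k := by
      rcases Nat.eq_zero_or_pos k with rfl | hk
      · simp at hle; linarith
      · exact_mod_cast hk
    refine hclose (b - z) (fun ε hε ↦ ?_) ?_
    · rw [abs_of_pos (sub_pos.2 hbz)]
      have h1 := hup a ha (ε / k) (div_pos hε (by exact_mod_cast hk))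
      push_cast at h1
      have h2 : (k : K) * (a - z) ≤ k * (ε / k * c) := by gcongr; linarith
      have h3 : (k : K) * (ε / k * c) = ε * c := by field_simp
      linarith
    · refine (hball z hzA b hb).trans (hmkc z ?_ ?_).le
      · apply hhalf; push_cast; linarith [mul_pos hqK hcpos]
      · by_contra! hlt
        exact hb₁ (hlow hlt.le hzA)
  · refine ⟨-z, .inr ⟨by simpa [mirrorCut] using hzA, fun b hb a ha k ↦ ?_⟩⟩
    simp only [mirrorCut, Set.mem_ofPred_eq, not_not] at hb ha
    by_contra! hle
    have haz : -a < z := by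
      by_contra! hlt
      exact hzA (hlow hlt ha)
    have hk : (0 : K) < k := by
      rcases Nat.eq_zero_or_pos k with rfl | hk
      · simp at hle; linarith
      · exact_mod_cast hk
    have hall (ε : ℚ) (hε : 0 < ε) : |z - -a| ≤ ε * c := by
      rw [abs_of_pos (sub_pos.2 haz)]
      have h1 := hdown (-b) hb (ε / k) (div_pos hε (by exact_mod_cast hk))
      push_cast at h1
      have h2 : (k : K) * (b - -z) ≤ k * (ε / k * c) := by gcongr; linarith
      have h3 : (k : K) * (ε / k * c) = ε * c := by field_simp
      linarith
    refine hclose (z - -a) hall ?_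
    refine (hball (-a) ha z hzA).trans (hmkc (-a) ?_ ?_).le
    · have h1 := hall (q₀ / 4) (by positivity)
      rw [abs_of_pos (sub_pos.2 haz)] at h1
      apply hhalf
      push_cast at h1 ⊢
      linarith [mul_pos hqK hcpos]
    · by_contra! hlt
      exact hb₁ (hlow hlt.le ha)

theorem mirrorCut_mirrorCut (A : Set K) : mirrorCut (mirrorCut A) = A := by
  ext; simp [mirrorCut]

theorem isLowerSet_mirrorCut {A : Set K} (h : IsLowerSet A) : IsLowerSet (mirrorCut A) :=
  fun _ _ hab ha hb ↦ ha (h (neg_le_neg hab) hb)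

/-- Every cut of a maximally valued field has a center on one of its sides. -/
theorem IsMaximallyValued.exists_isCutCenter (h : IsMaximallyValued K) {A : Set K}
    (hlow : IsLowerSet A) : ∃ z, IsCutCenter A z ∨ IsCutCenter (mirrorCut A) z := by
  -- These balls are centred below the cut and reach across it, so of two centres the upper one lies
  -- in the ball of the lower one.
  obtain ⟨x, hx⟩ := h.exists_center {p | p.1 ∈ A ∧ p.1 + p.2 ∉ A} (by
    rintro ⟨a, r⟩ ⟨ha, hr⟩ ⟨a', r'⟩ ⟨ha', hr'⟩
    simp only at ha hr ha' hr' ⊢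
    have h1 : a' < a + r := by
      by_contra! hle
      exact hr (hlow hle ha')
    have h2 : a < a' + r' := by
      by_contra! hle
      exact hr' (hlow hle ha)
    rcases le_total a a' with hle | hle
    · refine (min_le_left _ _).trans (mk_le_of_abs_le 1 ?_)
      rw [abs_sub_comm, abs_of_nonneg (sub_nonneg.2 hle)]
      simp only [Nat.cast_one, one_mul]
      linarith [le_abs_self r]
    · refine (min_le_right _ _).trans (mk_le_of_abs_le 1 ?_)
      rw [abs_of_nonneg (sub_nonneg.2 hle)]
      simp only [Nat.cast_one, one_mul]
      linarith [le_abs_self r'])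
  have hball : ∀ a ∈ A, ∀ b ∉ A, mk (b - a) ≤ mk (x - a) := fun a ha b hb ↦
    hx (a, b - a) ⟨ha, by simpa using hb⟩
  by_cases hxA : x ∈ A
  · exact h.exists_isCutCenter_of_mem hlow hxA hball
  -- For x above the cut, reflect; the ball condition around points above the cut follows from the
  -- one below by the ultrametric inequality.
  · obtain ⟨z, hz⟩ := h.exists_isCutCenter_of_mem (isLowerSet_mirrorCut hlow) (x := -x)
      (by simpa [mirrorCut] using hxA) (fun b hb a ha ↦ by
        simp only [mirrorCut, Set.mem_ofPred_eq, not_not] at hb ha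
        have h1 := hball (-a) ha (-b) hb
        have h2 : -x - b = -((x - -a) + (-a - -b)) := by ring
        have h3 : mk (-a - -b) = mk (-b - -a) := mk_sub_comm _ _
        have h4 : mk (a - b) = mk (-b - -a) := by congr 1; ring
        rw [h2, mk_neg, h4]
        exact le_trans (le_min h1 h3.ge) (min_le_mk_add _ _))
    rw [mirrorCut_mirrorCut] at hz
    exact ⟨z, hz.symm⟩

/-- Without a root, the supremum of the negative points defines a cut with negative values
arbitrarily close below and positive values above, contradicting the constant sign near a cut
centre. -/
theorem IsMaximallyValued.polynomialIVT (h : IsMaximallyValued K) : PolynomialIVT K := by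
  intro f a b hab ha hb
  by_contra! hno
  -- The downward closure of the negative points in [a, b), so above every element of A there is
  -- still a negative point.
  let A : Set K := {z | ∃ w, z ≤ w ∧ a ≤ w ∧ w < b ∧ f.eval w < 0}
  have hlow : IsLowerSet A := fun z z' hz ⟨w, hw⟩ ↦ ⟨w, hz.trans hw.1, hw.2⟩
  have haA : a ∈ A := ⟨a, le_rfl, le_rfl, hab, ha⟩
  have hbA : b ∉ A := fun ⟨w, h1, _, h2, _⟩ ↦ h2.not_ge h1
  have hne : Aᶜ.Nonempty := ⟨b, hbA⟩
  have hpos (z : K) (hz : z ∉ A) (hzb : z ≤ b) : 0 < f.eval z := by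
    rcases hzb.eq_or_lt with rfl | hzb
    · exact hb
    have haz : a < z := by
      by_contra! hle
      exact hz (hlow hle haA)
    refine (le_of_not_gt fun hlt ↦ hz ⟨z, le_rfl, haz.le, hzb, hlt⟩).lt_of_ne' ?_
    exact hno z haz hzb
  obtain ⟨x, hx | hx⟩ := h.exists_isCutCenter hlow
  · obtain ⟨s, u, v, hu, hua, hva, huv⟩ := hx.eval_sign hne hlow h.exists_mk_pow f
    have hm : max (x + u) a ∈ A := by
      rcases max_choice (x + u) a with h | h <;> rwa [h]
    obtain ⟨w, hw1, hw2, hw3, hw4⟩ := hm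
    have hwA : w ∈ A := ⟨w, le_rfl, hw2, hw3, hw4⟩
    have hwv : w < x + v := by
      by_contra! hle
      exact hva (hlow hle hwA)
    have hm' : min (x + v) b ∉ A := by
      rcases min_choice (x + v) b with h | h <;> rwa [h]
    have h1 := huv (w - x) (by linarith [le_max_left (x + u) a]) (by linarith)
    have h2 := huv (min (x + v) b - x)
      (by linarith [lt_min hwv hw3, le_max_left (x + u) a]) (by linarith [min_le_left (x + v) b])
    have h3 := hpos _ hm' (min_le_right _ _)
    simp only [add_sub_cancel] at h1 h2
    have h1' := h1.resolve_left hw4.ne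
    have h2' := h2.resolve_left h3.ne'
    have : s < 0 := by
      by_contra! hs
      nlinarith
    nlinarith
  · have hne' : (mirrorCut A)ᶜ.Nonempty := ⟨-a, by simpa [mirrorCut] using haA⟩
    obtain ⟨s, u, v, hu, hua, hva, huv⟩ := hx.eval_sign hne' (isLowerSet_mirrorCut hlow)
      h.exists_mk_pow (f.comp (-X))
    simp only [mirrorCut, Set.mem_ofPred_eq, not_not] at hua hva
    have hm : max (-(x + v)) a ∈ A := by
      rcases max_choice (-(x + v)) a with h | h <;> rwa [h]
    obtain ⟨w, hw1, hw2, hw3, hw4⟩ := hm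
    have hwA : w ∈ A := ⟨w, le_rfl, hw2, hw3, hw4⟩
    have hwv : w < -(x + u) := by
      by_contra! hle
      exact hua (hlow hle hwA)
    have hm' : min (-(x + u)) b ∉ A := by
      rcases min_choice (-(x + u)) b with h | h <;> rwa [h]
    have h1 := huv (-w - x) (by linarith) (by linarith [le_max_left (-(x + v)) a])
    have h2 := huv (-min (-(x + u)) b - x) (by linarith [min_le_left (-(x + u)) b])
      (by linarith [lt_min hwv hw3, le_max_left (-(x + v)) a])
    have h3 := hpos _ hm' (min_le_right _ _)
    simp only [add_sub_cancel, eval_comp, eval_neg, eval_X, neg_neg] at h1 h2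
    have h1' := h1.resolve_left hw4.ne
    have h2' := h2.resolve_left h3.ne'
    have : s < 0 := by
      by_contra! hs
      nlinarith
    nlinarith

end Cut

/-! ### From order balls to ultrametric balls, real numbers and divisibility -/

section OrderBall

variable {K : Type*} [Field K] [LinearOrder K] [IsStrictOrderedRing K]

theorem exists_mem_of_nested (hK : (orderBallSpace K).SphericallyComplete) {ι : Type*} [Nonempty ι]
    (l u : ι → K) (hlu : ∀ i, l i ≤ u i)
    (hn : ∀ i j, (l i ≤ l j ∧ u j ≤ u i) ∨ (l j ≤ l i ∧ u i ≤ u j)) :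
    ∃ x, ∀ i, l i ≤ x ∧ x ≤ u i := by
  have hball (i : ι) : orderBall ((l i + u i) / 2) ((u i - l i) / 2) = Set.Icc (l i) (u i) := by
    ext z
    simp only [orderBall, Set.mem_ofPred_eq, Set.mem_Icc, abs_le]
    constructor <;> rintro ⟨h1, h2⟩ <;> constructor <;> linarith
  obtain ⟨x, hx⟩ := hK (Set.range fun i ↦ Set.Icc (l i) (u i)) ⟨by
      rintro _ ⟨i, rfl⟩
      exact ⟨(l i + u i) / 2, (u i - l i) / 2, by linarith [hlu i], (hball i).symm⟩,
    Set.range_nonempty _, by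
      rintro _ ⟨i, rfl⟩ _ ⟨j, rfl⟩ _
      rcases hn i j with h | h
      · exact .inr (Set.Icc_subset_Icc h.1 h.2)
      · exact .inl (Set.Icc_subset_Icc h.1 h.2)⟩
  exact ⟨x, fun i ↦ hx _ ⟨i, rfl⟩⟩

/-- A pair (a, r) stands for the ball of all z with `mk r ≤ mk (z - a)`. If there is a smallest
ball, its centre works. Otherwise the ultrametric balls are replaced by order balls that are
genuinely nested. -/
theorem exists_center_of_nested (hK : (orderBallSpace K).SphericallyComplete) (S : Set (K × K))
    (hS : ∀ p ∈ S, ∀ q ∈ S, min (mk p.2) (mk q.2) ≤ mk (p.1 - q.1)) :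
    ∃ x, ∀ p ∈ S, mk p.2 ≤ mk (x - p.1) := by
  by_cases hmax : ∃ p ∈ S, ∀ q ∈ S, mk q.2 ≤ mk p.2
  · obtain ⟨p, hp, h⟩ := hmax
    exact ⟨p.1, fun q hq ↦ by simpa [h q hq] using hS p hp q hq⟩
  push Not at hmax
  choose! f hfS hf using hmax
  rcases S.eq_empty_or_nonempty with rfl | ⟨p₀, hp₀⟩
  · exact ⟨0, by simp⟩
  -- one representative for each radius class
  let C : Set (ArchimedeanClass K) := (fun p : K × K ↦ mk p.2) '' S
  choose p hpS hp using fun γ : C ↦ γ.2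
  have : Nonempty C := ⟨⟨_, p₀, hp₀, rfl⟩⟩
  -- The centre is taken from a strictly smaller ball. Then c γ - c δ is infinitesimal relative to
  -- the larger radius, which forces inclusion of the order intervals; the original centres could
  -- differ by a multiple of the radius.
  let c (γ : C) : K := (f (p γ)).1
  have hsub (γ δ : C) (hγδ : γ < δ) :
      c γ - |(p γ).2| ≤ c δ - |(p δ).2| ∧ c δ + |(p δ).2| ≤ c γ + |(p γ).2| := by
    have h1 : mk (p γ).2 < mk (p δ).2 := by
      have := hp γ; have := hp δ; simp_all
    have h2 : mk (p γ).2 < mk (c γ - c δ) :=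
      (lt_min (hf _ (hpS γ)) (h1.trans (hf _ (hpS δ)))).trans_le
        (hS _ (hfS _ (hpS γ)) _ (hfS _ (hpS δ)))
    have h3 := mk_lt_mk.1 h1 2
    have h4 := mk_lt_mk.1 h2 2
    simp only [nsmul_eq_mul, Nat.cast_ofNat] at h3 h4
    constructor <;> linarith [le_abs_self (c γ - c δ), neg_abs_le (c γ - c δ)]
  obtain ⟨x, hx⟩ := exists_mem_of_nested hK (fun γ : C ↦ c γ - |(p γ).2|)
    (fun γ ↦ c γ + |(p γ).2|) (fun γ ↦ by linarith [abs_nonneg (p γ).2]) (fun γ δ ↦ by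
      rcases lt_trichotomy γ δ with h | rfl | h
      · exact .inl (hsub _ _ h)
      · exact .inl ⟨le_rfl, le_rfl⟩
      · exact .inr (hsub _ _ h))
  refine ⟨x, fun q hq ↦ ?_⟩
  let γ : C := ⟨_, q, hq, rfl⟩
  have hγ : mk (p γ).2 = mk q.2 := hp γ
  have h1 : mk q.2 ≤ mk (x - c γ) := by
    rw [← hγ]
    refine mk_le_of_abs_le 1 ?_
    rw [Nat.cast_one, one_mul, abs_le]
    constructor <;> linarith [hx γ]
  have h2 : mk q.2 ≤ mk (c γ - q.1) :=
    (le_min (hγ ▸ (hf _ (hpS γ)).le) le_rfl).trans (hS _ (hfS _ (hpS γ)) q hq)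
  have h3 : x - q.1 = (x - c γ) + (c γ - q.1) := by ring
  rw [h3]
  exact (le_min h1 h2).trans (min_le_mk_add _ _)

theorem exists_real_of_nested (hK : (orderBallSpace K).SphericallyComplete) (r : ℝ) :
    ∃ x : K, ∀ q : ℚ, ((q : ℝ) < r → (q : K) < x) ∧ (r < q → x < q) := by
  obtain ⟨u, hu, hur, hulim⟩ := Real.exists_seq_rat_strictMono_tendsto r
  obtain ⟨v, hv, hvr, hvlim⟩ := Real.exists_seq_rat_strictAnti_tendsto r
  obtain ⟨x, hx⟩ := exists_mem_of_nested hK (fun n : ℕ ↦ (u n : K)) (fun n ↦ (v n : K))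
    (fun n ↦ by
      have : (u n : ℝ) ≤ v n := (hur n).le.trans (hvr n).le
      exact_mod_cast this)
    (fun m n ↦ by
      rcases le_total m n with h | h
      · exact .inl ⟨by exact_mod_cast hu.monotone h, by exact_mod_cast hv.antitone h⟩
      · exact .inr ⟨by exact_mod_cast hu.monotone h, by exact_mod_cast hv.antitone h⟩)
  refine ⟨x, fun q ↦ ⟨fun hq ↦ ?_, fun hq ↦ ?_⟩⟩
  · obtain ⟨n, hn⟩ := (hulim.eventually (lt_mem_nhds hq)).exists
    refine lt_of_lt_of_le ?_ (hx n).1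
    exact_mod_cast hn
  · obtain ⟨n, hn⟩ := (hvlim.eventually (gt_mem_nhds hq)).exists
    refine (hx n).2.trans_lt ?_
    exact_mod_cast hn

theorem mk_pow_le_mk_pow_iff {x y : K} {n : ℕ} (hn : n ≠ 0) :
    mk (x ^ n) ≤ mk (y ^ n) ↔ mk x ≤ mk y := by
  have key {x y : K} (h : mk x < mk y) : mk (x ^ n) < mk (y ^ n) := by
    rw [mk_lt_mk] at h ⊢
    intro m
    rw [abs_pow, abs_pow, nsmul_eq_mul]
    have h1 := h m
    rw [nsmul_eq_mul] at h1
    calc (m : K) * |y| ^ n ≤ (m : K) ^ n * |y| ^ n := by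
          gcongr
          exact_mod_cast Nat.le_self_pow hn m
      _ = (m * |y|) ^ n := by ring
      _ < |x| ^ n := by gcongr
  refine ⟨fun h ↦ ?_, fun h ↦ ?_⟩
  · by_contra! hlt
    exact (key hlt).not_ge h
  · rcases h.eq_or_lt with h | h
    · rw [mk_pow, mk_pow, h]
    · exact (key h).le

/-- If `c` has no `n`-th root up to archimedean equivalence, some `x` lies above the cut of
`n`-th roots, such that `x a ^ (n - 1)` is at most of the order of `c` for `a` below the cut. -/
theorem exists_mul_pow_le (hK : (orderBallSpace K).SphericallyComplete) {c : K} (hc : 0 < c)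
    {n : ℕ} (hn : ∀ t, mk (t ^ (n + 1)) ≠ mk c) :
    ∃ x, 0 < x ∧ mk (x ^ (n + 1)) < mk c ∧
      ∀ a, 0 < a → mk c < mk (a ^ (n + 1)) → x * a ^ n ≤ c := by
  let A : Set K := {a | 0 < a ∧ mk c < mk (a ^ (n + 1))}
  have hlt {a b : K} (ha : 0 ≤ a) (hb : 0 ≤ b) (h : mk a < mk b) : b < a := by
    have := mk_lt_mk.1 h 1
    rwa [one_smul, abs_of_nonneg ha, abs_of_nonneg hb] at this
  have hA (a : A) : (a : K) ≤ c / a ^ n := by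
    obtain ⟨a, ha, hac⟩ := a
    rw [le_div_iff₀ (pow_pos ha n), ← pow_succ']
    exact (hlt hc.le (by positivity) hac).le
  by_cases hne : A.Nonempty
  · have : Nonempty A := hne.to_subtype
    have hmono (a b : A) (h : (a : K) ≤ b) : c / (b : K) ^ n ≤ c / (a : K) ^ n := by
      have := a.2.1
      gcongr
    -- The intervals [a, c / a ^ n] shrink as a grows, so they form a nest.
    obtain ⟨x, hx⟩ := exists_mem_of_nested hK (fun a : A ↦ (a : K)) (fun a ↦ c / (a : K) ^ n) hA
      (fun a b ↦ by
        rcases le_total (a : K) b with h | h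
        · exact .inl ⟨h, hmono _ _ h⟩
        · exact .inr ⟨h, hmono _ _ h⟩)
    obtain ⟨a₀, ha₀⟩ := hne
    have hxpos : 0 < x := ha₀.1.trans_le (hx ⟨a₀, ha₀⟩).1
    refine ⟨x, hxpos, ?_, fun a ha hac ↦ ?_⟩
    · refine (le_of_not_gt fun hlt' ↦ ?_).lt_of_ne (hn x)
      -- If x were below the cut, so would be 2x, and then 2x ≤ x.
      have h2 : mk ((2 * x) ^ (n + 1)) = mk (x ^ (n + 1)) := by
        rw [mk_pow, mk_pow, mk_mul, mk_ofNat, zero_add]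
      have := (hx ⟨2 * x, by positivity, h2 ▸ hlt'⟩).1
      simp only at this
      linarith
    · rw [← le_div_iff₀ (pow_pos ha n)]
      exact (hx ⟨a, ha, hac⟩).2
  · have h1 : mk ((1 + c) ^ (n + 1)) ≤ mk c := by
      refine mk_le_of_abs_le 1 ?_
      rw [abs_of_pos hc, abs_of_nonneg (by positivity), Nat.cast_one, one_mul]
      have := le_self_pow₀ (M₀ := K) (show 1 ≤ 1 + c by linarith) (Nat.succ_ne_zero n)
      rw [Nat.succ_eq_add_one] at this
      linarith
    exact ⟨1 + c, by positivity, h1.lt_of_ne (hn _), fun a ha hac ↦ (hne ⟨a, ha, hac⟩).elim⟩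

/-- If c had no square root up to class, then c ≪ x² for the x of `exists_mul_pow_le`. The square of
a = 2c / x is then ≪ c, yet x * a = 2c > c. -/
theorem exists_mk_sq (hK : (orderBallSpace K).SphericallyComplete) {c : K} (hc : 0 < c) :
    ∃ t, 0 < t ∧ mk (t ^ 2) = mk c := by
  by_contra! hno
  have hno' : ∀ t, mk (t ^ (1 + 1)) ≠ mk c := fun t ht ↦ by
    rcases eq_or_ne t 0 with rfl | h0
    · simp at ht
      exact hc.ne ht.symm
    · exact hno |t| (abs_pos.2 h0) (by simpa using ht)
  obtain ⟨x, hx, hxc, h⟩ := exists_mul_pow_le hK hc hno'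
  have h1 : mk c < mk ((2 * c / x) ^ 2) := by
    rw [mk_lt_mk] at hxc ⊢
    intro m
    have h2 := hxc (4 * m + 1)
    simp only [nsmul_eq_mul] at h2 ⊢
    rw [abs_of_pos hc, abs_of_pos (by positivity)] at h2 ⊢
    have h3 : (m : K) * (2 * c / x) ^ 2 = (4 * m * c) * c / x ^ 2 := by field_simp; ring
    rw [h3, div_lt_iff₀ (by positivity)]
    push_cast at h2
    nlinarith
  have h2 := h (2 * c / x) (by positivity) h1
  have h3 : x * (2 * c / x) ^ 1 = 2 * c := by field_simp
  linarith

theorem exists_mk_two_pow (hK : (orderBallSpace K).SphericallyComplete) {c : K} (hc : 0 < c)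
    (m : ℕ) : ∃ t, 0 < t ∧ mk (t ^ 2 ^ m) = mk c := by
  induction m with
  | zero => exact ⟨c, hc, by simp⟩
  | succ m ih =>
    obtain ⟨t, ht, htc⟩ := ih
    obtain ⟨s, hs, hst⟩ := exists_mk_sq hK ht
    refine ⟨s, hs, ?_⟩
    rw [pow_succ', pow_mul, mk_pow, hst, ← mk_pow, htc]

/-- Divisibility by 2 gives t with M v(t) = v(c) - (n + 1) v(x) > 0 for a large power M of 2. For a
= x t ^ k with M / (n + 1) < k < M / n, the power a ^ (n + 1) is ≪ c while x a ^ n is ≫ c, against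
the choice of x. -/
theorem exists_mk_pow_of_nested (hK : (orderBallSpace K).SphericallyComplete) {n : ℕ}
    (hn : n ≠ 0) (c : K) : ∃ t, mk (t ^ n) = mk c := by
  obtain ⟨n, rfl⟩ := Nat.exists_eq_succ_of_ne_zero hn
  wlog hc : 0 < c generalizing c
  · rcases (not_lt.1 hc).eq_or_lt with rfl | hc
    · exact ⟨0, by simp⟩
    · simpa using this (-c) (by simpa using hc)
  by_contra! hno
  rcases Nat.eq_zero_or_pos n with rfl | hnpos
  · exact hno c (by simp)
  obtain ⟨x, hx, hxc, h⟩ := exists_mul_pow_le hK hc hno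
  -- work in the value group with a small fraction of the distance from `x` to the cut
  set M := 2 ^ ((n + 1) * (n + 1)) with hM
  obtain ⟨t, ht, htc⟩ := exists_mk_two_pow hK (show 0 < c / x ^ (n + 1) by positivity)
    ((n + 1) * (n + 1))
  rw [← hM] at htc
  -- The least integer above M / (n + 1); it stays below M / n because M > (n + 1)².
  set k := M / (n + 1) + 1 with hk
  have hMbig : (n + 1) * (n + 1) < M := Nat.lt_two_pow_self
  have hk1 : M < k * (n + 1) := by
    rw [hk, add_mul, one_mul, mul_comm]
    exact Nat.lt_mul_div_succ M (Nat.succ_pos n)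
  have hk2 : k * n < M := by
    have h1 : M / (n + 1) * (n + 1) ≤ M := Nat.div_mul_le_self _ _
    have h2 : n + 1 ≤ M / (n + 1) := (Nat.le_div_iff_mul_le (Nat.succ_pos n)).2 hMbig.le
    rw [hk]
    nlinarith
  have hxne : x ^ (n + 1) ≠ 0 := by positivity
  have htM : mk (x ^ (n + 1) * t ^ M) = mk c := by
    rw [mk_mul, htc, ← mk_mul, mul_div_cancel₀ _ hxne]
  have ht1 : 0 < mk t := by
    by_contra! hle
    have h1 : mk (t ^ M) ≤ mk ((1 : K) ^ M) :=
      (mk_pow_le_mk_pow_iff (by positivity)).2 (by simpa using hle)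
    have h2 : mk c ≤ mk (x ^ (n + 1)) := by
      rw [← htM, mk_mul]
      calc _ ≤ mk (x ^ (n + 1)) + mk ((1 : K) ^ M) := by gcongr
        _ = _ := by simp
    exact h2.not_gt hxc
  have hinf (d : ℕ) (hd : 0 < d) : ∀ m : ℕ, (m : K) * t ^ d < 1 := by
    intro m
    have h0 := mk_lt_mk.1 (show mk (1 : K) < mk t by simpa using ht1)
    have h1 := h0 m
    have h2 := h0 1
    simp only [nsmul_eq_mul, abs_one, abs_of_pos ht, Nat.cast_one, one_mul] at h1 h2
    calc (m : K) * t ^ d ≤ m * t := by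
          gcongr
          exact pow_le_of_le_one ht.le h2.le hd.ne'
      _ < 1 := h1
  have hsmall : mk c < mk ((x * t ^ k) ^ (n + 1)) := by
    have h1 : (x * t ^ k) ^ (n + 1) = x ^ (n + 1) * t ^ M * t ^ (k * (n + 1) - M) := by
      rw [mul_assoc, ← pow_add, Nat.add_sub_cancel' hk1.le, mul_pow, ← pow_mul]
    rw [h1, mk_mul, htM, ← mk_mul, mk_lt_mk]
    intro m
    have h2 := hinf (k * (n + 1) - M) (by omega) m
    rw [nsmul_eq_mul, abs_of_pos hc, abs_of_pos (by positivity)]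
    calc (m : K) * (c * t ^ (k * (n + 1) - M)) = c * (m * t ^ (k * (n + 1) - M)) := by ring
      _ < c * 1 := by gcongr
      _ = c := mul_one c
  have hle := h (x * t ^ k) (by positivity) hsmall
  obtain ⟨m, hm⟩ := exists_abs_le_of_mk_le htM.le
  rw [abs_of_pos hc, abs_of_pos (by positivity)] at hm
  have h2 := hinf (M - k * n) (by omega) m
  have h3 : x * (x * t ^ k) ^ n * t ^ (M - k * n) = x ^ (n + 1) * t ^ M := by
    rw [mul_pow, ← pow_mul]
    calc x * (x ^ n * t ^ (k * n)) * t ^ (M - k * n)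
        = x ^ (n + 1) * (t ^ (k * n) * t ^ (M - k * n)) := by ring
      _ = _ := by rw [← pow_add, Nat.add_sub_cancel' hk2.le]
  have h4 : 0 < t ^ (M - k * n) := by positivity
  have h5 : (m : K) * (c * t ^ (M - k * n)) < c := by
    calc (m : K) * (c * t ^ (M - k * n)) = c * (m * t ^ (M - k * n)) := by ring
      _ < c * 1 := by gcongr
      _ = c := mul_one c
  refine absurd hm (not_le.2 ?_)
  rw [← h3]
  calc (m : K) * (x * (x * t ^ k) ^ n * t ^ (M - k * n)) ≤ m * (c * t ^ (M - k * n)) := by gcongr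
    _ < c := h5

theorem isMaximallyValued_of_sphericallyComplete (hK : (orderBallSpace K).SphericallyComplete) :
    IsMaximallyValued K where
  exists_center := exists_center_of_nested hK
  exists_real := exists_real_of_nested hK
  exists_mk_pow _ hn := exists_mk_pow_of_nested hK hn

end OrderBall

/-! ### The power series field is maximally valued -/

section HahnSeries

variable {Γ : Type*} [AddCommGroup Γ] [LinearOrder Γ] [IsOrderedAddMonoid Γ]

theorem mk_le_mk_iff_orderTop {x y : Lex (HahnSeries Γ ℝ)} :
    mk x ≤ mk y ↔ (ofLex x).orderTop ≤ (ofLex y).orderTop := by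
  rw [← (HahnSeries.archimedeanClassOrderIsoWithTop Γ ℝ).le_iff_le]
  simp

theorem mk_eq_mk_iff_orderTop {x y : Lex (HahnSeries Γ ℝ)} :
    mk x = mk y ↔ (ofLex x).orderTop = (ofLex y).orderTop := by
  simp only [le_antisymm_iff, mk_le_mk_iff_orderTop]

theorem hahnSeries_le_orderTop {x : HahnSeries Γ ℝ} {y : WithTop Γ}
    (h : ∀ γ : Γ, γ < y → x.coeff γ = 0) : y ≤ x.orderTop := by
  by_contra! hlt
  have hne := hlt.ne_top
  have h1 := h (x.orderTop.untop hne) (by simpa using hlt)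
  rw [HahnSeries.coeff_untop_eq_leadingCoeff] at h1
  exact (HahnSeries.leadingCoeff_ne_zero.2 (HahnSeries.orderTop_ne_top.1 hne)) h1

/-- The centres are glued: the coefficient at γ is read off from any ball whose radius has order
above γ, and compatibility makes this independent of the ball. -/
theorem hahnSeries_exists_center (S : Set (Lex (HahnSeries Γ ℝ) × Lex (HahnSeries Γ ℝ)))
    (hS : ∀ p ∈ S, ∀ q ∈ S, min (mk p.2) (mk q.2) ≤ mk (p.1 - q.1)) :
    ∃ x, ∀ p ∈ S, mk p.2 ≤ mk (x - p.1) := by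
  classical
  let c (γ : Γ) : ℝ :=
    if h : ∃ p ∈ S, (γ : WithTop Γ) < (ofLex p.2).orderTop then (ofLex h.choose.1).coeff γ else 0
  have hc (p) (hp : p ∈ S) (γ : Γ) (hγ : (γ : WithTop Γ) < (ofLex p.2).orderTop) :
      c γ = (ofLex p.1).coeff γ := by
    have h : ∃ p ∈ S, (γ : WithTop Γ) < (ofLex p.2).orderTop := ⟨p, hp, hγ⟩
    have h1 := hS _ h.choose_spec.1 p hp
    rw [min_le_iff, mk_le_mk_iff_orderTop, mk_le_mk_iff_orderTop] at h1
    have h2 : (γ : WithTop Γ) < (ofLex (h.choose.1 - p.1)).orderTop := by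
      rcases h1 with h1 | h1
      · exact h.choose_spec.2.trans_le h1
      · exact hγ.trans_le h1
    have h3 := HahnSeries.coeff_eq_zero_of_lt_orderTop h2
    rw [ofLex_sub, HahnSeries.coeff_sub, sub_eq_zero] at h3
    simp only [c, dif_pos h, h3]
  -- Up to the exponent f 0 the glued series agrees with a single centre, so a sequence staying
  -- below f 0 lives in a partially well-ordered support; a sequence that rises above f 0 already
  -- has an increasing pair.
  have hpwo : (Function.support c).IsPWO := by
    intro f
    have h0 : ∃ p ∈ S, ((f 0 : Γ) : WithTop Γ) < (ofLex p.2).orderTop := by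
      by_contra h
      exact (f 0).2 (by simp only [c, dif_neg h])
    obtain ⟨p, hp, hp0⟩ := h0
    by_cases hle : ∀ n, f n ≤ f 0
    · have hmem (n : ℕ) : (f n : Γ) ∈ (ofLex p.1).support := by
        rw [HahnSeries.mem_support, ← hc p hp (f n)
          ((WithTop.coe_le_coe.2 (show (f n : Γ) ≤ f 0 from hle n)).trans_lt hp0)]
        exact (f n).2
      exact (ofLex p.1).isPWO_support fun n ↦ ⟨f n, hmem n⟩
    · push Not at hle
      obtain ⟨n, hn⟩ := hle
      exact ⟨0, n, Nat.pos_of_ne_zero fun h ↦ (h ▸ hn).false, hn.le⟩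
  refine ⟨toLex ⟨c, hpwo⟩, fun p hp ↦ ?_⟩
  rw [mk_le_mk_iff_orderTop]
  refine hahnSeries_le_orderTop fun γ hγ ↦ ?_
  rw [ofLex_sub, HahnSeries.coeff_sub, sub_eq_zero]
  exact hc p hp γ hγ

theorem hahnSeries_toLex_C_lt {r s : ℝ} (h : r < s) :
    toLex (HahnSeries.C (Γ := Γ) r) < toLex (HahnSeries.C s) := by
  rw [HahnSeries.lt_iff]
  refine ⟨0, fun j hj ↦ ?_, ?_⟩
  · simp [HahnSeries.coeff_single_of_ne hj.ne]
  · simpa using h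

theorem hahnSeries_exists_real (r : ℝ) : ∃ x : Lex (HahnSeries Γ ℝ),
    ∀ q : ℚ, ((q : ℝ) < r → (q : Lex (HahnSeries Γ ℝ)) < x) ∧ (r < q → x < q) := by
  refine ⟨toLex (HahnSeries.C r), fun q ↦ ?_⟩
  have hq : (q : Lex (HahnSeries Γ ℝ)) = toLex (HahnSeries.C (q : ℝ)) := by
    rw [map_ratCast]; rfl
  rw [hq]
  exact ⟨hahnSeries_toLex_C_lt, hahnSeries_toLex_C_lt⟩

theorem isMaximallyValued_hahnSeries (hdiv : ∀ n : ℕ, n ≠ 0 → ∀ γ : Γ, ∃ δ, n • δ = γ) :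
    IsMaximallyValued (Lex (HahnSeries Γ ℝ)) where
  exists_center := hahnSeries_exists_center
  exists_real := hahnSeries_exists_real
  exists_mk_pow n hn c := by
    rcases eq_or_ne c 0 with rfl | hc
    · exact ⟨0, by simp [hn]⟩
    obtain ⟨δ, hδ⟩ := hdiv n hn ((ofLex c).orderTop.untop (HahnSeries.orderTop_ne_top.2 hc))
    refine ⟨toLex (HahnSeries.single δ 1), ?_⟩
    rw [mk_eq_mk_iff_orderTop, ofLex_pow, ofLex_toLex, HahnSeries.single_pow, one_pow,
      HahnSeries.orderTop_single one_ne_zero, hδ, WithTop.coe_untop]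

end HahnSeries

/-! ### Lifting the value group to positive elements -/

section CrossSection

variable {K : Type*} [Field K] [LinearOrder K] [IsStrictOrderedRing K]

theorem PolynomialIVT.exists_pow_eq (h : PolynomialIVT K) {c : K} (hc : 0 < c) {n : ℕ}
    (hn : n ≠ 0) : ∃ t, 0 < t ∧ t ^ n = c := by
  have h1 : 1 + c ≤ (1 + c) ^ n := le_self_pow₀ (by linarith) hn
  obtain ⟨t, ht, _, ht0⟩ := h (X ^ n - C c) 0 (1 + c) (by linarith) (by simpa [hn] using hc)
    (by simp only [eval_sub, eval_pow, eval_X, eval_C]; linarith)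
  exact ⟨t, ht, by simpa [sub_eq_zero] using ht0⟩

variable (K) in
/-- The group of positive units of the natural valuation. -/
def positiveUnits : Subgroup Kˣ where
  carrier := {u | 0 < (u : K) ∧ mk (u : K) = 0}
  mul_mem' := fun ⟨h1, h2⟩ ⟨h3, h4⟩ ↦ ⟨by simpa using mul_pos h1 h3, by simp [h2, h4]⟩
  one_mem' := by simp
  inv_mem' := fun ⟨h1, h2⟩ ↦ ⟨by simpa using h1, by simp [h2]⟩

/-- Roots of positive units exist and are positive units, so the group is divisible, hence
injective, and the identity extends to all of `Kˣ`. -/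
theorem PolynomialIVT.exists_retraction (h : PolynomialIVT K) :
    ∃ r : Kˣ →* positiveUnits K, ∀ u : positiveUnits K, r u = u := by
  have hroot (n : ℕ) (hn : n ≠ 0) (u : positiveUnits K) : ∃ t : positiveUnits K, t ^ n = u := by
    obtain ⟨t, ht, htn⟩ := h.exists_pow_eq u.2.1 hn
    have ht0 : mk t = 0 := by
      have h1 : mk (t ^ n) = mk ((1 : K) ^ n) := by rw [htn, u.2.2, one_pow, mk_one]
      rw [← mk_one]
      exact le_antisymm ((mk_pow_le_mk_pow_iff hn).1 h1.le) ((mk_pow_le_mk_pow_iff hn).1 h1.ge)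
    exact ⟨⟨Units.mk0 t ht.ne', ht, ht0⟩, by ext; simpa using htn⟩
  let _ : DivisibleBy (Additive (positiveUnits K)) ℕ :=
    divisibleByOfSMulRightSurj _ _ fun {n} hn u ↦ by
      obtain ⟨t, ht⟩ := hroot n hn u.toMul
      exact ⟨Additive.ofMul t, by simp only [← ofMul_pow, ht]; rfl⟩
  let _ : DivisibleBy (Additive (positiveUnits K)) ℤ := AddGroup.divisibleByIntOfDivisibleByNat _
  obtain ⟨r, hr⟩ := (Module.Baer.of_divisible
    (Additive (positiveUnits K))).extension_property_addMonoidHom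
    (MonoidHom.toAdditive (positiveUnits K).subtype)
    (by exact Subtype.val_injective) (AddMonoidHom.id _)
  exact ⟨MonoidHom.toAdditive.symm r, fun u ↦ congrArg (fun f ↦ (f (Additive.ofMul u)).toMul) hr⟩

/-- The value group can be lifted to a group of positive elements. -/
theorem PolynomialIVT.exists_crossSection (h : PolynomialIVT K) :
    ∃ s : Multiplicative (NaturalValueGroup K) →* K,
      ∀ γ, 0 < s γ ∧ mk (s γ) = (γ.toAdd : ArchimedeanClass K) := by
  obtain ⟨r, hr⟩ := h.exists_retraction
  have hlift (γ : NaturalValueGroup K) :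
      ∃ g : Kˣ, 0 < (g : K) ∧ mk (g : K) = (γ : ArchimedeanClass K) := by
    obtain ⟨x, hx⟩ := mk_surjective (M := K) γ
    have hx0 : x ≠ 0 := by
      rintro rfl
      have h1 : (γ : ArchimedeanClass K) + (-γ : NaturalValueGroup K) = 0 := AddUnits.add_neg γ
      rw [← hx, mk_zero, top_add] at h1
      exact top_ne_zero h1
    exact ⟨Units.mk0 |x| (abs_ne_zero.2 hx0), abs_pos.2 hx0, by simpa using hx⟩
  choose g hg hgv using hlift
  -- The homomorphism x ↦ x / r(x) kills positive units, so on positive elements it depends only on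
  -- the value, which it preserves.
  have hinv (u : positiveUnits K) (x : Kˣ) : x * u * ((r (x * u) : positiveUnits K) : Kˣ)⁻¹ =
      x * ((r x : positiveUnits K) : Kˣ)⁻¹ := by
    rw [map_mul, hr, Subgroup.coe_mul]
    group
  have hind (x y : Kˣ) (hx : 0 < (x : K)) (hy : 0 < (y : K)) (hxy : mk (x : K) = mk (y : K)) :
      x * ((r x : positiveUnits K) : Kˣ)⁻¹ = y * ((r y : positiveUnits K) : Kˣ)⁻¹ := by
    have hu : y⁻¹ * x ∈ positiveUnits K := by
      refine ⟨by simpa using mul_pos (inv_pos.2 hy) hx, ?_⟩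
      rw [Units.val_mul, mk_mul, hxy, ← mk_mul, ← Units.val_mul]
      simp
    simpa using hinv ⟨_, hu⟩ y
  refine ⟨⟨⟨fun γ ↦ ((g γ.toAdd * ((r (g γ.toAdd) : positiveUnits K) : Kˣ)⁻¹ : Kˣ) : K), ?_⟩, ?_⟩,
    fun γ ↦ ⟨?_, ?_⟩⟩
  · rw [hind (g (Multiplicative.toAdd 1)) 1 (hg _) (by simp) (by rw [hgv]; simp)]
    simp
  · intro γ δ
    simp only
    rw [hind (g (Multiplicative.toAdd (γ * δ))) (g γ.toAdd * g δ.toAdd) (hg _)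
      (by simpa using mul_pos (hg γ.toAdd) (hg δ.toAdd)) (by simp [hgv])]
    rw [map_mul, ← Units.val_mul, Subgroup.coe_mul]
    congr 1
    rw [mul_inv]
    exact mul_mul_mul_comm _ _ _ _
  · have h1 := (r (g γ.toAdd)).2.1
    simpa using mul_pos (hg γ.toAdd) (inv_pos.2 h1)
  · have h1 := (r (g γ.toAdd)).2.2
    simp [h1, hgv]

/-- The sign of a finite sum of elements of distinct archimedean classes is the sign of the
dominant term. -/
theorem sum_pos_iff_of_strictMono {Γ : Type*} [LinearOrder Γ] {s : Γ → K} (hs : ∀ γ, 0 < s γ)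
    (hmono : StrictMono fun γ ↦ mk (s γ)) {f : Γ →₀ ℤ} {γ₀ : Γ} (h0 : f γ₀ ≠ 0)
    (hmin : ∀ γ, f γ ≠ 0 → γ₀ ≤ γ) : 0 < f.sum (fun γ n ↦ (n : K) * s γ) ↔ 0 < f γ₀ := by
  classical
  rw [Finsupp.sum, ← Finset.add_sum_erase _ _ (Finsupp.mem_support_iff.2 h0)]
  set E := ∑ γ ∈ f.support.erase γ₀, (f γ : K) * s γ
  have hf (γ : Γ) (hγ : f γ ≠ 0) : mk ((f γ : K) * s γ) = mk (s γ) := by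
    rw [mk_mul, mk_intCast hγ, zero_add]
  have hE : mk ((f γ₀ : K) * s γ₀) < mk E := by
    rw [hf _ h0]
    refine AddValuation.map_lt_sum (v := addValuation K) ?_ fun γ hγ ↦ ?_
    · simpa using (hs γ₀).ne'
    · rw [Finset.mem_erase, Finsupp.mem_support_iff] at hγ
      rw [addValuation_apply, hf γ hγ.2]
      exact hmono ((hmin γ hγ.2).lt_of_ne' hγ.1)
  have hlt := mk_lt_mk.1 hE 1
  rw [one_smul] at hlt
  rcases h0.lt_or_gt with h0 | h0
  · have h1 : (f γ₀ : K) * s γ₀ < 0 := mul_neg_of_neg_of_pos (by exact_mod_cast h0) (hs _)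
    rw [abs_of_neg h1] at hlt
    exact iff_of_false (by linarith [le_abs_self E]) h0.not_gt
  · have h1 : 0 < (f γ₀ : K) * s γ₀ := mul_pos (by exact_mod_cast h0) (hs _)
    rw [abs_of_pos h1] at hlt
    exact iff_of_true (by linarith [neg_abs_le E]) h0

end CrossSection

/-! ### Signs and monotonicity of polynomials from the intermediate value property -/

section Monotone

variable {K : Type*} [Field K] [LinearOrder K] [IsStrictOrderedRing K]

theorem PolynomialIVT.exists_root_of_pos_of_neg (h : PolynomialIVT K) (f : K[X]) {a b : K}
    (hab : a < b) (ha : 0 < f.eval a) (hb : f.eval b < 0) : ∃ c, a < c ∧ c < b ∧ f.eval c = 0 := by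
  obtain ⟨c, h1, h2, h3⟩ := h (-f) a b hab (by simpa using ha) (by simpa using hb)
  exact ⟨c, h1, h2, by simpa using h3⟩

theorem PolynomialIVT.pos_of_pos (h : PolynomialIVT K) (f : K[X]) {a b u v : K}
    (hu : a < u ∧ u < b) (hv : a < v ∧ v < b) (hno : ∀ c, a < c → c < b → f.eval c ≠ 0)
    (hpos : 0 < f.eval u) : 0 < f.eval v := by
  refine (le_of_not_gt fun hlt ↦ ?_).lt_of_ne' (hno v hv.1 hv.2)
  rcases lt_trichotomy u v with huv | rfl | huv
  · obtain ⟨c, h1, h2, h3⟩ := h.exists_root_of_pos_of_neg f huv hpos hlt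
    exact hno c (hu.1.trans h1) (h2.trans hv.2) h3
  · exact lt_asymm hpos hlt
  · obtain ⟨c, h1, h2, h3⟩ := h f v u huv hlt hpos
    exact hno c (hv.1.trans h1) (h2.trans hu.2) h3

theorem PolynomialIVT.pos_iff_pos (h : PolynomialIVT K) (f : K[X]) (hno : ∀ c, f.eval c ≠ 0)
    (u v : K) : 0 < f.eval u ↔ 0 < f.eval v := by
  have key (u v : K) : 0 < f.eval u → 0 < f.eval v :=
    h.pos_of_pos f (a := min u v - 1) (b := max u v + 1)
      ⟨by linarith [min_le_left u v], by linarith [le_max_left u v]⟩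
      ⟨by linarith [min_le_right u v], by linarith [le_max_right u v]⟩ fun c _ _ ↦ hno c
  exact ⟨key u v, key v u⟩

/-- A polynomial with positive derivative on an interval is strictly increasing there. -/
theorem PolynomialIVT.eval_lt_eval (h : PolynomialIVT K) (f : K[X]) {u v : K} (huv : u < v)
    (hder : ∀ c, u ≤ c → c ≤ v → 0 < f.derivative.eval c) : f.eval u < f.eval v := by
  by_contra! hle
  -- With f - f(u) = (X - u) k, the factor k is positive at u and, if the claim fails, has a first
  -- root w in (u, v]. There f'(w) = (w - u) k'(w) makes k increase through w, so k = (X - w) m has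
  -- an earlier root, where m changes sign.
  obtain ⟨k, hk⟩ := dvd_iff_isRoot.2 (show (f - C (f.eval u)).IsRoot u by simp)
  have heval (z : K) : f.eval z - f.eval u = (z - u) * k.eval z := by
    simpa using congrArg (eval z) hk
  have hder' (z : K) : f.derivative.eval z = k.eval z + (z - u) * k.derivative.eval z := by
    simpa [derivative_mul] using congrArg (fun p ↦ eval z (derivative p)) hk
  have hku : 0 < k.eval u := by simpa [hder'] using hder u le_rfl huv.le
  have hkv : k.eval v ≤ 0 := by
    by_contra! hpos
    have := mul_pos (sub_pos.2 huv) hpos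
    linarith [heval v]
  have hk0 : k ≠ 0 := by
    rintro rfl
    simp at hku
  have hroots : (k.roots.toFinset.filter fun w ↦ u < w ∧ w ≤ v).Nonempty := by
    rcases hkv.eq_or_lt with h0 | hlt
    · exact ⟨v, by simp [hk0, h0, huv]⟩
    · obtain ⟨c, h1, h2, h3⟩ := h.exists_root_of_pos_of_neg k huv hku hlt
      exact ⟨c, by simp [hk0, h1, h2.le, h3]⟩
  obtain ⟨w, hw, hmin⟩ := Finset.exists_min_image _ id hroots
  simp only [Finset.mem_filter, Multiset.mem_toFinset, mem_roots hk0, IsRoot.def, id] at hw hmin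
  obtain ⟨hw0, huw, hwv⟩ := hw
  obtain ⟨m, hm⟩ := dvd_iff_isRoot.2 (show k.IsRoot w from hw0)
  have hkm (z : K) : k.eval z = (z - w) * m.eval z := by simpa using congrArg (eval z) hm
  have hmw : 0 < m.eval w := by
    have h1 : k.derivative.eval w = m.eval w := by
      simpa [derivative_mul] using congrArg (fun p ↦ eval w (derivative p)) hm
    have h2 := hder w huw.le hwv
    rw [hder', hw0, h1, zero_add] at h2
    exact (pos_iff_pos_of_mul_pos h2).1 (sub_pos.2 huw)
  have hmu : m.eval u < 0 := by
    rw [hkm] at hku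
    by_contra! hge
    exact hku.not_ge (mul_nonpos_of_nonpos_of_nonneg (by linarith) hge)
  obtain ⟨c, h1, h2, h3⟩ := h m u w huw hmu hmw
  exact h2.not_ge (hmin c ⟨by rw [hkm, h3, mul_zero], h1, h2.le.trans hwv⟩)

end Monotone

/-! ### Partial isomorphisms, their maximal extensions and back-and-forth -/

section PartialIso

variable {K L : Type*} [Field K] [LinearOrder K] [IsStrictOrderedRing K]
  [Field L] [LinearOrder L] [IsStrictOrderedRing L]

/-- A subring of `K × L` which is the graph of an order preserving isomorphism between a subring
of `K` and a subring of `L`. -/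
def IsPartialIso (R : Subring (K × L)) : Prop :=
  ∀ p ∈ R, 0 < p.1 ↔ 0 < p.2

/-- The inverse of a partial isomorphism. -/
def swapSubring (R : Subring (K × L)) : Subring (L × K) :=
  R.comap (RingEquiv.prodComm : L × K ≃+* K × L)

/-- A maximal partial isomorphism, which meets all archimedean classes of both fields. -/
structure IsMaximalPartialIso (R : Subring (K × L)) : Prop where
  intro ::
  isPartialIso : IsPartialIso R
  maximal : ∀ R' : Subring (K × L), R ≤ R' → IsPartialIso R' → R' ≤ R
  exists_fst : ∀ x : K, x ≠ 0 → ∃ p ∈ R, 0 < p.1 ∧ mk p.1 = mk x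
  exists_snd : ∀ y : L, y ≠ 0 → ∃ p ∈ R, 0 < p.2 ∧ mk p.2 = mk y

/-- A pair of polynomials corresponding to each other under a partial isomorphism. -/
def PolyPair (R : Subring (K × L)) (f : K[X]) (g : L[X]) : Prop :=
  ∃ h : R[X], h.map ((RingHom.fst K L).comp R.subtype) = f ∧
    h.map ((RingHom.snd K L).comp R.subtype) = g

/-- Two elements realize corresponding cuts. -/
def SameCut (R : Subring (K × L)) (x : K) (y : L) : Prop :=
  ∀ p ∈ R, (p.1 < x ↔ p.2 < y) ∧ (x < p.1 ↔ y < p.2)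

/-- All roots of polynomials of degree less than `n` lie in the partial isomorphism. -/
def RootsMem (R : Subring (K × L)) (n : ℕ) : Prop :=
  ∀ f g, PolyPair R f g → f ≠ 0 → f.natDegree < n →
    (∀ x, f.eval x = 0 → ∃ y, (x, y) ∈ R) ∧ ∀ y, g.eval y = 0 → ∃ x, (x, y) ∈ R

variable {R : Subring (K × L)}

theorem IsPartialIso.lt_iff (h : IsPartialIso R) {p q : K × L} (hp : p ∈ R) (hq : q ∈ R) :
    p.1 < q.1 ↔ p.2 < q.2 := by
  simpa using h _ (R.sub_mem hq hp)

theorem IsPartialIso.le_iff (h : IsPartialIso R) {p q : K × L} (hp : p ∈ R) (hq : q ∈ R) :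
    p.1 ≤ q.1 ↔ p.2 ≤ q.2 := by
  rw [← not_lt, ← not_lt, h.lt_iff hq hp]

theorem IsPartialIso.eq_iff (h : IsPartialIso R) {p q : K × L} (hp : p ∈ R) (hq : q ∈ R) :
    p.1 = q.1 ↔ p.2 = q.2 := by
  rw [le_antisymm_iff, le_antisymm_iff, h.le_iff hp hq, h.le_iff hq hp]

theorem IsPartialIso.eq_zero_iff (h : IsPartialIso R) {p : K × L} (hp : p ∈ R) :
    p.1 = 0 ↔ p.2 = 0 :=
  h.eq_iff hp R.zero_mem

theorem IsPartialIso.abs_mem (h : IsPartialIso R) {p : K × L} (hp : p ∈ R) :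
    (|p.1|, |p.2|) ∈ R := by
  have := h.le_iff R.zero_mem hp
  rcases le_total 0 p.1 with h1 | h1
  · rw [abs_of_nonneg h1, abs_of_nonneg (this.1 h1)]
    exact hp
  · have := h.le_iff hp R.zero_mem
    rw [abs_of_nonpos h1, abs_of_nonpos (this.1 h1)]
    exact R.neg_mem hp

theorem IsPartialIso.mk_le_mk_iff (h : IsPartialIso R) {p q : K × L} (hp : p ∈ R) (hq : q ∈ R) :
    mk p.1 ≤ mk q.1 ↔ mk p.2 ≤ mk q.2 := by
  rw [mk_le_mk, mk_le_mk]
  exact exists_congr fun n ↦ h.le_iff (h.abs_mem hq) (R.nsmul_mem (h.abs_mem hp) n)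

theorem IsPartialIso.mk_lt_mk_iff (h : IsPartialIso R) {p q : K × L} (hp : p ∈ R) (hq : q ∈ R) :
    mk p.1 < mk q.1 ↔ mk p.2 < mk q.2 := by
  rw [← not_le, ← not_le, h.mk_le_mk_iff hq hp]

theorem IsPartialIso.swap (h : IsPartialIso R) : IsPartialIso (swapSubring R) :=
  fun _ hp ↦ (h _ hp).symm

theorem IsMaximalPartialIso.swap (h : IsMaximalPartialIso R) :
    IsMaximalPartialIso (swapSubring R) where
  isPartialIso := h.isPartialIso.swap
  maximal R' hle hR' p hp :=
    h.maximal (swapSubring R') (fun q hq ↦ hle (x := q.swap) hq) hR'.swap (x := p.swap) hp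
  exists_fst y hy := by
    obtain ⟨p, hp, h1⟩ := h.exists_snd y hy
    exact ⟨p.swap, hp, h1⟩
  exists_snd x hx := by
    obtain ⟨p, hp, h1⟩ := h.exists_fst x hx
    exact ⟨p.swap, hp, h1⟩

theorem PolyPair.swap {f : K[X]} {g : L[X]} (h : PolyPair R f g) :
    PolyPair (swapSubring R) g f := by
  obtain ⟨p, rfl, rfl⟩ := h
  let e : R →+* swapSubring R :=
    ((RingEquiv.prodComm : K × L ≃+* L × K).toRingHom.comp R.subtype).codRestrict _
      fun p ↦ p.2
  refine ⟨p.map e, ?_, ?_⟩ <;> rw [Polynomial.map_map] <;> rfl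

theorem PolyPair.neg {f : K[X]} {g : L[X]} (h : PolyPair R f g) : PolyPair R (-f) (-g) := by
  obtain ⟨p, rfl, rfl⟩ := h
  exact ⟨-p, by simp, by simp⟩

theorem PolyPair.derivative {f : K[X]} {g : L[X]} (h : PolyPair R f g) :
    PolyPair R (derivative f) (derivative g) := by
  obtain ⟨p, rfl, rfl⟩ := h
  exact ⟨Polynomial.derivative p, by simp [derivative_map], by simp [derivative_map]⟩

theorem PolyPair.eval_mem {f : K[X]} {g : L[X]} (h : PolyPair R f g) {p : K × L} (hp : p ∈ R) :
    (f.eval p.1, g.eval p.2) ∈ R := by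
  obtain ⟨q, rfl, rfl⟩ := h
  convert! (q.eval ⟨p, hp⟩).2 using 1
  ext
  · exact (eval_map_apply ((RingHom.fst K L).comp R.subtype) (⟨p, hp⟩ : R))
  · exact (eval_map_apply ((RingHom.snd K L).comp R.subtype) (⟨p, hp⟩ : R))

theorem IsPartialIso.fst_injective (h : IsPartialIso R) :
    Function.Injective ((RingHom.fst K L).comp R.subtype) := by
  intro p q hpq
  exact Subtype.ext (Prod.ext hpq ((h.eq_iff p.2 q.2).1 hpq))

theorem IsPartialIso.snd_injective (h : IsPartialIso R) :
    Function.Injective ((RingHom.snd K L).comp R.subtype) := by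
  intro p q hpq
  exact Subtype.ext (Prod.ext ((h.eq_iff p.2 q.2).2 hpq) hpq)

theorem PolyPair.natDegree_eq {f : K[X]} {g : L[X]} (h : PolyPair R f g) (hR : IsPartialIso R) :
    f.natDegree = g.natDegree := by
  obtain ⟨p, rfl, rfl⟩ := h
  rw [natDegree_map_eq_of_injective hR.fst_injective,
    natDegree_map_eq_of_injective hR.snd_injective]

theorem PolyPair.eq_zero_iff {f : K[X]} {g : L[X]} (h : PolyPair R f g) (hR : IsPartialIso R) :
    f = 0 ↔ g = 0 := by
  obtain ⟨p, rfl, rfl⟩ := h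
  rw [Polynomial.map_eq_zero_iff hR.fst_injective, Polynomial.map_eq_zero_iff hR.snd_injective]

theorem RootsMem.swap {n : ℕ} (h : RootsMem R n) (hR : IsPartialIso R) :
    RootsMem (swapSubring R) n := by
  intro f g hfg hf hn
  have := h g f hfg.swap ((hfg.swap.eq_zero_iff hR).not.2 hf)
    ((hfg.swap.natDegree_eq hR).trans_lt hn)
  exact ⟨this.2, this.1⟩

theorem PolyPair.exists_factor {f : K[X]} {g : L[X]} (h : PolyPair R f g) (hR : IsPartialIso R)
    {p : K × L} (hp : p ∈ R) (h0 : f.eval p.1 = 0) :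
    ∃ f' g', PolyPair R f' g' ∧ f = (X - C p.1) * f' ∧ g = (X - C p.2) * g' := by
  obtain ⟨q, rfl, rfl⟩ := h
  have h1 : ((RingHom.fst K L).comp R.subtype) (q.eval ⟨p, hp⟩) = 0 := by
    rw [← eval_map_apply]
    exact h0
  have h2 : q.IsRoot ⟨p, hp⟩ := hR.fst_injective (h1.trans (map_zero _).symm)
  obtain ⟨q', rfl⟩ := dvd_iff_isRoot.2 h2
  exact ⟨_, _, ⟨q', rfl, rfl⟩, by simp, by simp⟩

/-- Adjoining (x, y) to R gives exactly the pairs (f(x), g(y)), so the sign condition says that this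
larger ring is still a partial isomorphism. -/
theorem IsMaximalPartialIso.mem_of_sign (hR : IsMaximalPartialIso R) {x : K} {y : L}
    (h : ∀ f g, PolyPair R f g → (0 < f.eval x ↔ 0 < g.eval y)) : (x, y) ∈ R := by
  have heval (f : R[X]) : eval₂ R.subtype (x, y) f =
      ((f.map ((RingHom.fst K L).comp R.subtype)).eval x,
        (f.map ((RingHom.snd K L).comp R.subtype)).eval y) := by
    ext
    · exact (hom_eval₂ f R.subtype (RingHom.fst K L) (x, y)).trans (eval_map _ _).symm
    · exact (hom_eval₂ f R.subtype (RingHom.snd K L) (x, y)).trans (eval_map _ _).symm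
  refine hR.maximal (eval₂RingHom R.subtype (x, y)).range (fun p hp ↦ ⟨C ⟨p, hp⟩, by simp⟩) ?_
    ⟨X, by simp⟩
  rintro _ ⟨f, rfl⟩
  rw [coe_eval₂RingHom, heval]
  exact h _ _ ⟨f, rfl, rfl⟩

/-- Allowing denominators from R that are positive preserves the sign condition, so a maximal R is
the graph of an isomorphism of fields. The inverse is taken componentwise. -/
theorem IsMaximalPartialIso.inv_mem (hR : IsMaximalPartialIso R) {p : K × L} (hp : p ∈ R) :
    p⁻¹ ∈ R := by
  have key {q z : K × L} (hq : q ∈ R) (hq0 : 0 < q.1) (hz : q * z ∈ R) : 0 < z.1 ↔ 0 < z.2 := by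
    have h1 := hR.isPartialIso _ hz
    rw [Prod.fst_mul, Prod.snd_mul, mul_pos_iff_of_pos_left hq0,
      mul_pos_iff_of_pos_left ((hR.isPartialIso q hq).1 hq0)] at h1
    exact h1
  let R' : Subring (K × L) :=
    { carrier := {z | ∃ q ∈ R, 0 < q.1 ∧ q * z ∈ R}
      mul_mem' := by
        rintro z w ⟨q, hq, hq0, hz⟩ ⟨q', hq', hq0', hw⟩
        exact ⟨q * q', R.mul_mem hq hq', mul_pos hq0 hq0', by
          rw [mul_mul_mul_comm]; exact R.mul_mem hz hw⟩
      one_mem' := ⟨1, R.one_mem, one_pos, by simp⟩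
      add_mem' := by
        rintro z w ⟨q, hq, hq0, hz⟩ ⟨q', hq', hq0', hw⟩
        refine ⟨q * q', R.mul_mem hq hq', mul_pos hq0 hq0', ?_⟩
        rw [show q * q' * (z + w) = q' * (q * z) + q * (q' * w) by ring]
        exact R.add_mem (R.mul_mem hq' hz) (R.mul_mem hq hw)
      zero_mem' := ⟨1, R.one_mem, one_pos, by simp⟩
      neg_mem' := by
        rintro z ⟨q, hq, hq0, hz⟩
        exact ⟨q, hq, hq0, by rw [mul_neg]; exact R.neg_mem hz⟩ }
  by_cases h0 : p.1 = 0
  · have h1 : p = 0 := Prod.ext h0 ((hR.isPartialIso.eq_zero_iff hp).1 h0)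
    have h2 : (0 : K × L)⁻¹ = 0 := by ext <;> simp
    rw [h1, h2]
    exact R.zero_mem
  have h0' : p.2 ≠ 0 := (hR.isPartialIso.eq_zero_iff hp).not.1 h0
  refine hR.maximal R' (fun z hz ↦ ⟨1, R.one_mem, one_pos, by simpa using hz⟩)
    (fun z ⟨q, hq, hq0, hz⟩ ↦ key hq hq0 hz) ⟨p * p, R.mul_mem hp hp, mul_self_pos.2 h0, ?_⟩
  have : p * p * p⁻¹ = p := by
    ext
    · simp [h0]
    · simp [h0']
  rwa [this]

theorem IsMaximalPartialIso.exists_small (hR : IsMaximalPartialIso R) {ε : K} (hε : 0 < ε) :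
    ∃ p ∈ R, 0 < p.1 ∧ p.1 < ε := by
  obtain ⟨p, hp, hp0, hpε⟩ := hR.exists_fst ε hε.ne'
  obtain ⟨n, hn⟩ := exists_abs_le_of_mk_le hpε.ge
  rw [abs_of_pos hp0, abs_of_pos hε] at hn
  refine ⟨p * ((n + 1 : ℕ) : K × L)⁻¹, R.mul_mem hp (hR.inv_mem (natCast_mem R _)), ?_, ?_⟩
  · simp only [Prod.fst_mul, Prod.fst_inv, Prod.fst_natCast]
    positivity
  · simp only [Prod.fst_mul, Prod.fst_inv, Prod.fst_natCast]
    rw [← div_eq_mul_inv, div_lt_iff₀ (by positivity)]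
    push_cast
    linarith

theorem IsMaximalPartialIso.exists_gt (hR : IsMaximalPartialIso R) (x : K) :
    ∃ p ∈ R, x < p.1 := by
  obtain ⟨p, hp, hp0, hlt⟩ := hR.exists_small (ε := (|x| + 1)⁻¹) (by positivity)
  refine ⟨p⁻¹, hR.inv_mem hp, ?_⟩
  rw [lt_inv_comm₀ hp0 (by positivity)] at hlt
  simp only [Prod.fst_inv]
  linarith [le_abs_self x]

theorem IsMaximalPartialIso.exists_lt_of_finset (hR : IsMaximalPartialIso R) {x : K}
    (s : Finset K) (hs : ∀ a ∈ s, ∃ b, (a, b) ∈ R) :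
    ∃ p ∈ R, p.1 < x ∧ ∀ a ∈ s, a < x → a ≤ p.1 := by
  classical
  induction s using Finset.induction_on with
  | empty =>
    obtain ⟨p, hp, hlt⟩ := hR.exists_gt (-x)
    exact ⟨-p, R.neg_mem hp, by simpa using neg_lt.1 hlt, by simp⟩
  | insert a s _ ih =>
    obtain ⟨p, hp, hpx, h⟩ := ih fun a ha ↦ hs a (Finset.mem_insert_of_mem ha)
    obtain ⟨b, hb⟩ := hs a (Finset.mem_insert_self _ _)
    simp only [Finset.mem_insert, forall_eq_or_imp]
    by_cases hc : a < x ∧ p.1 < a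
    · exact ⟨(a, b), hb, hc.1, fun _ ↦ le_rfl, fun c hc' hcx ↦ (h c hc' hcx).trans hc.2.le⟩
    · exact ⟨p, hp, hpx, fun hax ↦ le_of_not_gt fun hlt ↦ hc ⟨hax, hlt⟩, h⟩

theorem IsMaximalPartialIso.exists_gt_of_finset (hR : IsMaximalPartialIso R) {x : K}
    (s : Finset K) (hs : ∀ a ∈ s, ∃ b, (a, b) ∈ R) :
    ∃ p ∈ R, x < p.1 ∧ ∀ a ∈ s, x < a → p.1 ≤ a := by
  classical
  obtain ⟨p, hp, hpx, h⟩ := hR.exists_lt_of_finset (x := -x) (s.image Neg.neg) (by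
    intro a ha
    obtain ⟨c, hc, rfl⟩ := Finset.mem_image.1 ha
    obtain ⟨b, hb⟩ := hs c hc
    exact ⟨-b, R.neg_mem hb⟩)
  refine ⟨-p, R.neg_mem hp, by simpa using lt_neg.1 hpx, fun a ha hxa ↦ ?_⟩
  have := h (-a) (Finset.mem_image_of_mem _ ha) (neg_lt_neg hxa)
  simpa using neg_le.1 this

/-- A root on either side lies in R and splits off a linear factor, whose sign at x is given by the
cut. With no roots left on either side, the sign is constant and can be compared at 0. -/
theorem RootsMem.pos_iff {n : ℕ} (hn : RootsMem R n) (hR : IsPartialIso R)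
    (hK : PolynomialIVT K) (hL : PolynomialIVT L) {x : K} {y : L} (hxy : SameCut R x y)
    (hx : ∀ p ∈ R, p.1 ≠ x) {f : K[X]} {g : L[X]} (hfg : PolyPair R f g)
    (hdeg : f.natDegree < n) : 0 < f.eval x ↔ 0 < g.eval y := by
  induction hd : f.natDegree using Nat.strong_induction_on generalizing f g with
  | _ d ih =>
  subst hd
  by_cases hf : f = 0
  · rw [hf, (hfg.eq_zero_iff hR).1 hf]
    simp
  have hroot (p : K × L) (hp : p ∈ R) (h0 : f.eval p.1 = 0) : 0 < f.eval x ↔ 0 < g.eval y := by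
    obtain ⟨f', g', hfg', rfl, rfl⟩ := hfg.exists_factor hR hp h0
    have hf' : f' ≠ 0 := right_ne_zero_of_mul hf
    have hd' : f'.natDegree < ((X - C p.1) * f').natDegree := by
      rw [natDegree_mul (X_sub_C_ne_zero _) hf', natDegree_X_sub_C]
      omega
    have h1 := ih _ hd' hfg' (hd'.trans hdeg) rfl
    -- The negated pair supplies the equivalence for negative values, needed when the linear factor
    -- is negative.
    have h2 := ih _ (by rwa [natDegree_neg]) hfg'.neg (by rw [natDegree_neg]; exact hd'.trans hdeg)
      rfl
    simp only [eval_neg, Left.neg_pos_iff] at h2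
    simp only [eval_mul, eval_sub, eval_X, eval_C]
    rcases (hx p hp).lt_or_gt with h3 | h3
    · rw [mul_pos_iff_of_pos_left (sub_pos.2 h3),
        mul_pos_iff_of_pos_left (sub_pos.2 ((hxy p hp).1.1 h3)), h1]
    · have h4 := (hxy p hp).2.1 h3
      rw [← neg_mul_neg, mul_pos_iff_of_pos_left (by linarith), Left.neg_pos_iff, h2,
        ← neg_mul_neg (y - p.2), mul_pos_iff_of_pos_left (by linarith), Left.neg_pos_iff]
  obtain ⟨hnf, hng⟩ := hn f g hfg hf hdeg
  by_cases h1 : ∃ a, f.eval a = 0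
  · obtain ⟨a, ha⟩ := h1
    obtain ⟨b, hb⟩ := hnf a ha
    exact hroot _ hb ha
  by_cases h2 : ∃ b, g.eval b = 0
  · obtain ⟨b, hb⟩ := h2
    obtain ⟨a, ha⟩ := hng b hb
    exact hroot _ ha ((hR.eq_zero_iff (hfg.eval_mem ha)).2 hb)
  push Not at h1 h2
  rw [hK.pos_iff_pos f h1 x 0, hL.pos_iff_pos g h2 y 0]
  exact hR _ (hfg.eval_mem R.zero_mem)

theorem sameCut_of_lt {x : K} {y : L}
    (h1 : ∀ p ∈ R, p.1 < x → p.2 < y) (h2 : ∀ p ∈ R, x < p.1 → y < p.2)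
    (hx : ∀ p ∈ R, p.1 ≠ x) : SameCut R x y := by
  intro p hp
  rcases (hx p hp).lt_or_gt with h | h
  · have := h1 p hp h
    exact ⟨iff_of_true h this, iff_of_false h.not_gt this.not_gt⟩
  · have := h2 p hp h
    exact ⟨iff_of_false h.not_gt this.not_gt, iff_of_true h this⟩

/-- Polynomials over a maximal partial isomorphism can be replaced by their remainders modulo
a polynomial vanishing at both points. -/
theorem PolyPair.exists_remainder (hR : IsMaximalPartialIso R) {f f' : K[X]} {g g' : L[X]}
    (hfg : PolyPair R f g) (hf : 0 < f.natDegree) (hfg' : PolyPair R f' g') {x : K} {y : L}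
    (hx : f.eval x = 0) (hy : g.eval y = 0) :
    ∃ r s, PolyPair R r s ∧ r.natDegree < f.natDegree ∧ r.eval x = f'.eval x ∧
      s.eval y = g'.eval y := by
  obtain ⟨h, rfl, rfl⟩ := hfg
  obtain ⟨q, rfl, rfl⟩ := hfg'
  have hinj := hR.isPartialIso.fst_injective
  rw [natDegree_map_eq_of_injective hinj] at hf ⊢
  set c := h.leadingCoeff with hc
  have hc0 : c ≠ 0 := by
    rw [hc, leadingCoeff_ne_zero]
    rintro rfl
    simp at hf
  have hc1 : (c : K × L).1 ≠ 0 := fun h0 ↦ hc0 (hinj (h0.trans (map_zero _).symm))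
  have hc2 : (c : K × L).2 ≠ 0 := (hR.isPartialIso.eq_zero_iff c.2).not.1 hc1
  let u : R := ⟨(c : K × L)⁻¹, hR.inv_mem c.2⟩
  have huc : u * c = 1 := by
    ext
    · exact inv_mul_cancel₀ hc1
    · exact inv_mul_cancel₀ hc2
  have hmonic : (C u * h).Monic := monic_C_mul_of_mul_leadingCoeff_eq_one huc
  have hu0 : u ≠ 0 := by
    rintro h0
    rw [h0, zero_mul] at huc
    exact zero_ne_one (congrArg (fun z : R ↦ (z : K × L).1) huc)
  have : IsDomain R := hinj.isDomain _
  have hdeg : (C u * h).natDegree = h.natDegree := natDegree_C_mul hu0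
  refine ⟨_, _, ⟨q %ₘ (C u * h), rfl, rfl⟩, ?_, ?_, ?_⟩
  · rw [natDegree_map_eq_of_injective hinj, ← hdeg]
    refine natDegree_modByMonic_lt q hmonic fun h1 ↦ ?_
    rw [h1, natDegree_one] at hdeg
    exact hf.ne hdeg
  all_goals
    nth_rw 2 [← modByMonic_add_div q (C u * h)]
    simp [hx, hy]

/-- The derivative has smaller degree, so its roots lie in R and x can be enclosed by points of R
between which f and g are strictly monotone. The root y of g found there realizes the cut of x, and
(x, y) could be adjoined to R. -/
theorem RootsMem.exists_of_root {n : ℕ} (hn : RootsMem R n) (hR : IsMaximalPartialIso R)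
    (hK : PolynomialIVT K) (hL : PolynomialIVT L) {f : K[X]} {g : L[X]} (hfg : PolyPair R f g)
    (hf : f ≠ 0) (hdeg : f.natDegree ≤ n) {x : K} (hx : f.eval x = 0) : ∃ y, (x, y) ∈ R := by
  by_contra hxR
  have hxne : ∀ p ∈ R, p.1 ≠ x := fun p hp h ↦ hxR ⟨p.2, h ▸ hp⟩
  have hdpos : 0 < f.natDegree := by
    rw [Nat.pos_iff_ne_zero]
    intro h0
    rw [eq_C_of_natDegree_eq_zero h0, eval_C] at hx
    rw [eq_C_of_natDegree_eq_zero h0, hx] at hf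
    simp at hf
  have hder0 : derivative f ≠ 0 := fun h0 ↦ hdpos.ne' (derivative_eq_zero.1 h0)
  have hderdeg : (derivative f).natDegree < n := (natDegree_derivative_lt hdpos.ne').trans_le hdeg
  obtain ⟨hroot₁, hroot₂⟩ := hn _ _ hfg.derivative hder0 hderdeg
  have hderx : (derivative f).eval x ≠ 0 := fun h0 ↦ hxR (hroot₁ x h0)
  wlog hpos : 0 < (derivative f).eval x generalizing f g
  · refine this hfg.neg (by simpa using hf) (by simpa using hdeg) (by simpa using hx)
      (by simpa using hdpos) ?_ ?_ ?_ ?_ ?_ ?_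
    · simpa using hder0
    · simpa using hderdeg
    · simpa using hroot₁
    · simpa using hroot₂
    · simpa using hderx
    · simpa using (not_lt.1 hpos).lt_of_ne hderx
  have hmem : ∀ a ∈ (derivative f).roots.toFinset, ∃ b, (a, b) ∈ R := fun a ha ↦
    hroot₁ a (by simpa [hder0] using ha)
  obtain ⟨p, hp, hpx, hpmax⟩ := hR.exists_lt_of_finset (x := x) _ hmem
  obtain ⟨q, hq, hxq, hqmin⟩ := hR.exists_gt_of_finset (x := x) _ hmem
  have hno₁ (c : K) (h1 : p.1 < c) (h2 : c < q.1) : (derivative f).eval c ≠ 0 := by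
    intro h0
    have hc : c ∈ (derivative f).roots.toFinset := by simp [hder0, h0]
    rcases lt_trichotomy c x with h | rfl | h
    · exact h1.not_ge (hpmax c hc h)
    · exact hderx h0
    · exact h2.not_ge (hqmin c hc h)
  have hno₂ (c : L) (h1 : p.2 < c) (h2 : c < q.2) : (derivative g).eval c ≠ 0 := by
    intro h0
    obtain ⟨a, ha⟩ := hroot₂ c h0
    exact hno₁ a ((hR.isPartialIso.lt_iff hp ha).2 h1) ((hR.isPartialIso.lt_iff ha hq).2 h2)
      ((hR.isPartialIso.eq_zero_iff (hfg.derivative.eval_mem ha)).2 h0)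
  -- The derivative may vanish at p and q, so the endpoints are moved inward within R, without
  -- passing x.
  obtain ⟨δ, hδ, hδ0, hδp⟩ := hR.exists_small (sub_pos.2 hpx)
  obtain ⟨ε, hε, hε0, hεq⟩ := hR.exists_small (sub_pos.2 hxq)
  have hδ0' := (hR.isPartialIso _ hδ).1 hδ0
  have hε0' := (hR.isPartialIso _ hε).1 hε0
  have hp' := R.add_mem hp hδ
  have hq' := R.sub_mem hq hε
  have hder₁ (c : K) (h1 : p.1 < c) (h2 : c < q.1) : 0 < (derivative f).eval c :=
    hK.pos_of_pos _ ⟨hpx, hxq⟩ ⟨h1, h2⟩ hno₁ hpos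
  have hmono₁ (c d : K) (h1 : p.1 < c) (h2 : c < d) (h3 : d < q.1) : f.eval c < f.eval d :=
    hK.eval_lt_eval f h2 fun z h4 h5 ↦ hder₁ z (h1.trans_le h4) (h5.trans_lt h3)
  have hpq' : (p + δ).2 < (q - ε).2 := (hR.isPartialIso.lt_iff hp' hq').1 (by
    simp only [Prod.fst_add, Prod.fst_sub]; linarith)
  have hder₂ (c : L) (h1 : p.2 < c) (h2 : c < q.2) : 0 < (derivative g).eval c := by
    refine hL.pos_of_pos _ (u := (p + δ).2) ⟨by simpa using hδ0', ?_⟩ ⟨h1, h2⟩ hno₂ ?_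
    · refine hpq'.trans ?_
      simpa using hε0'
    · refine (hR.isPartialIso _ (hfg.derivative.eval_mem hp')).1 (hder₁ _ ?_ ?_)
      · simpa using hδ0
      · simp only [Prod.fst_add]; linarith
  have hmono₂ (c d : L) (h1 : p.2 < c) (h2 : c < d) (h3 : d < q.2) : g.eval c < g.eval d :=
    hL.eval_lt_eval g h2 fun z h4 h5 ↦ hder₂ z (h1.trans_le h4) (h5.trans_lt h3)
  -- the corresponding root on the other side
  obtain ⟨y, hy1, hy2, hy⟩ := hL g (p + δ).2 (q - ε).2 hpq'
    ((hR.isPartialIso.lt_iff (hfg.eval_mem hp') R.zero_mem).1 (by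
      rw [Prod.fst_zero, ← hx]
      refine hmono₁ _ _ ?_ ?_ hxq
      · simpa using hδ0
      · simp only [Prod.fst_add]; linarith))
    ((hR.isPartialIso.lt_iff R.zero_mem (hfg.eval_mem hq')).1 (by
      rw [Prod.fst_zero, ← hx]
      refine hmono₁ _ _ hpx ?_ ?_
      · simp only [Prod.fst_sub]; linarith
      · simpa using hε0))
  have hpy : p.2 < y := by
    simp only [Prod.snd_add] at hy1
    linarith
  have hyq : y < q.2 := by
    simp only [Prod.snd_sub] at hy2
    linarith
  have hcut : SameCut R x y := by
    refine sameCut_of_lt (fun r hr hrx ↦ ?_) (fun r hr hxr ↦ ?_) hxne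
    · rcases le_or_gt r.1 p.1 with h1 | h1
      · exact ((hR.isPartialIso.le_iff hr hp).1 h1).trans_lt hpy
      · by_contra! hle
        have h2 := (hR.isPartialIso.lt_iff (hfg.eval_mem hr) R.zero_mem).1
          ((hmono₁ _ _ h1 hrx hxq).trans_eq hx)
        have h3 := (hR.isPartialIso.lt_iff hr hq).1 (hrx.trans hxq)
        rcases hle.eq_or_lt with rfl | hlt
        · exact h2.ne hy
        · exact h2.not_gt (hy.symm.trans_lt (hmono₂ _ _ hpy hlt h3))
    · rcases le_or_gt q.1 r.1 with h1 | h1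
      · exact hyq.trans_le ((hR.isPartialIso.le_iff hq hr).1 h1)
      · by_contra! hle
        have h2 := (hR.isPartialIso.lt_iff R.zero_mem (hfg.eval_mem hr)).1
          (hx.symm.trans_lt (hmono₁ _ _ hpx hxr h1))
        have h3 := (hR.isPartialIso.lt_iff hp hr).1 (hpx.trans hxr)
        rcases hle.eq_or_lt with rfl | hlt
        · exact h2.ne hy.symm
        · exact h2.not_gt ((hmono₂ _ _ h3 hlt hyq).trans_eq hy)
  -- Division by f leaves remainders of degree below n with the same values at x and y, and for
  -- these the cut decides the sign.
  refine hxR ⟨y, hR.mem_of_sign fun f' g' hfg' ↦ ?_⟩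
  obtain ⟨r, s, hrs, hrdeg, hrx, hsy⟩ := hfg.exists_remainder hR hdpos hfg' hx hy
  rw [← hrx, ← hsy]
  exact hn.pos_iff hR.isPartialIso hK hL hcut hxne hrs (hrdeg.trans_le hdeg)

theorem IsMaximalPartialIso.rootsMem (hR : IsMaximalPartialIso R) (hK : PolynomialIVT K)
    (hL : PolynomialIVT L) (n : ℕ) : RootsMem R n := by
  induction n with
  | zero => exact fun f g _ _ h ↦ (Nat.not_lt_zero _ h).elim
  | succ n ih =>
    intro f g hfg hf hdeg
    rw [Nat.lt_succ_iff] at hdeg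
    refine ⟨fun x hx ↦ ih.exists_of_root hR hK hL hfg hf hdeg hx, fun y hy ↦ ?_⟩
    exact (ih.swap hR.isPartialIso).exists_of_root hR.swap hL hK hfg.swap
      ((hfg.eq_zero_iff hR.isPartialIso).not.1 hf)
      ((hfg.natDegree_eq hR.isPartialIso).symm.trans_le hdeg) hy

theorem IsMaximalPartialIso.mem_of_sameCut (hR : IsMaximalPartialIso R) (hK : PolynomialIVT K)
    (hL : PolynomialIVT L) {x : K} {y : L} (h : SameCut R x y) (hx : ∀ p ∈ R, p.1 ≠ x) :
    (x, y) ∈ R :=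
  hR.mem_of_sign fun f _ hfg ↦ (hR.rootsMem hK hL (f.natDegree + 1)).pos_iff hR.isPartialIso hK hL
    h hx hfg (Nat.lt_succ_self _)

/-- If `x` has no best approximation in a maximal partial isomorphism, then its cut is realized
on the other side. -/
theorem IsMaximalPartialIso.exists_sameCut_of_immediate (hR : IsMaximalPartialIso R)
    (hL : IsMaximallyValued L) {x : K} (hx : ∀ p ∈ R, p.1 ≠ x)
    (himm : ∀ p ∈ R, ∃ q ∈ R, mk (x - p.1) < mk (x - q.1)) : ∃ y, SameCut R x y := by
  have hri := hR.isPartialIso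
  -- The balls around elements p of R that contain x are carried over to L: c in R has the value of
  -- x - p, and its second component serves as radius.
  obtain ⟨y, hy⟩ := hL.exists_center
    {z | ∃ p ∈ R, ∃ c ∈ R, mk c.1 = mk (x - p.1) ∧ z = (p.2, c.2)} (by
      rintro _ ⟨p, hp, c, hc, hcp, rfl⟩ _ ⟨q, hq, d, hd, hdq, rfl⟩
      have h1 : min (mk c.1) (mk d.1) ≤ mk (p - q).1 := by
        have h2 : (p - q).1 = (x - q.1) - (x - p.1) := by simp
        rw [hcp, hdq, h2, min_comm]
        exact min_le_mk_sub _ _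
      rw [min_le_iff, hri.mk_le_mk_iff hc (R.sub_mem hp hq),
        hri.mk_le_mk_iff hd (R.sub_mem hp hq), ← min_le_iff] at h1
      exact h1)
  -- A better approximation q of x also lies much closer to y than to p on the other side, so x and
  -- y are on the same side of p as q is.
  have key (p) (hp : p ∈ R) : ∃ q ∈ R, mk (x - p.1) < mk (x - q.1) ∧
      mk (q - p).2 < mk (y - q.2) := by
    obtain ⟨q, hq, hpq⟩ := himm p hp
    obtain ⟨d, hd, _, hdq⟩ := hR.exists_fst (x - q.1) (sub_ne_zero.2 (hx q hq).symm)
    refine ⟨q, hq, hpq, lt_of_lt_of_le ?_ (hy _ ⟨q, hq, d, hd, hdq, rfl⟩)⟩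
    rw [← hri.mk_lt_mk_iff (R.sub_mem hq hp) hd, hdq]
    have h2 : (q - p).1 = (x - p.1) - (x - q.1) := by simp
    rwa [h2, mk_sub_eq_mk_left hpq]
  refine ⟨y, sameCut_of_lt (fun p hp hlt ↦ ?_) (fun p hp hlt ↦ ?_) hx⟩
  · obtain ⟨q, hq, h1, h2⟩ := key p hp
    have h3 := lt_of_mk_lt_mk_of_nonneg h1 (sub_nonneg.2 hlt.le)
    have h4 : p.2 < q.2 := (hri.lt_iff hp hq).1 (by linarith)
    have h5 := mk_lt_mk.1 h2 1
    rw [one_smul, Prod.snd_sub, abs_of_pos (sub_pos.2 h4)] at h5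
    linarith [neg_abs_le (y - q.2)]
  · obtain ⟨q, hq, h1, h2⟩ := key p hp
    have h3 := lt_of_mk_lt_mk_of_nonpos h1 (sub_nonpos.2 hlt.le)
    have h4 : q.2 < p.2 := (hri.lt_iff hq hp).1 (by linarith)
    have h5 := mk_lt_mk.1 h2 1
    rw [one_smul, Prod.snd_sub, abs_of_neg (sub_neg.2 h4)] at h5
    linarith [le_abs_self (y - q.2)]

theorem exists_real_of_mk_nonneg {x : K} (hx : 0 ≤ mk x) :
    ∃ r : ℝ, ∀ q : ℚ, ((q : ℝ) < r → (q : K) < x) ∧ (r < q → x < q) := by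
  refine ⟨stdPart x, fun q ↦ ⟨fun h ↦ ?_, fun h ↦ ?_⟩⟩
  · by_contra! hle
    have := stdPart_monotoneOn hx (mk_ratCast_nonneg q) hle
    rw [stdPart_ratCast] at this
    exact this.not_gt h
  · by_contra! hle
    have := stdPart_monotoneOn (mk_ratCast_nonneg q) hx hle
    rw [stdPart_ratCast] at this
    exact this.not_gt h

theorem exists_rat_btwn_close (r : ℝ) (n : ℕ) :
    ∃ q q' : ℚ, (q : ℝ) < r ∧ r < q' ∧ q' < q + 1 / (n + 1) := by
  have hpos : (0 : ℝ) < 1 / (n + 1) := by positivity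
  obtain ⟨q, hq1, hq2⟩ := exists_rat_btwn (show r - 1 / (n + 1) / 2 < r by linarith)
  obtain ⟨q', hq1', hq2'⟩ := exists_rat_btwn (show r < r + 1 / (n + 1) / 2 by linarith)
  refine ⟨q, q', hq2, hq1', ?_⟩
  rw [← Rat.cast_lt (K := ℝ)]
  push_cast
  linarith

theorem IsMaximalPartialIso.ratCast_mem (hR : IsMaximalPartialIso R) (q : ℚ) :
    ((q : K), (q : L)) ∈ R := by
  have h1 : ((q : K), (q : L)) = ((q.num : ℤ) : K × L) * ((q.den : ℕ) : K × L)⁻¹ := by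
    ext
    · simp [← div_eq_mul_inv, Rat.cast_def]
    · simp [← div_eq_mul_inv, Rat.cast_def]
  rw [h1]
  exact R.mul_mem (intCast_mem R _) (hR.inv_mem (natCast_mem R _))

/-- In the remaining case a is a best approximation of x, and c in R has the value of x - a. The
unit z = (x - a) / c is not infinitesimally close to any element of R, so its cut over R depends
only on its standard part r, which some w in L realizes. -/
theorem IsMaximalPartialIso.exists_sameCut (hR : IsMaximalPartialIso R)
    (hL : IsMaximallyValued L) {x : K} (hx : ∀ p ∈ R, p.1 ≠ x) : ∃ y, SameCut R x y := by
  by_cases himm : ∀ p ∈ R, ∃ q ∈ R, mk (x - p.1) < mk (x - q.1)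
  · exact hR.exists_sameCut_of_immediate hL hx himm
  push Not at himm
  obtain ⟨a, ha, hmax⟩ := himm
  have hri := hR.isPartialIso
  obtain ⟨c, hc, hc0, hca⟩ := hR.exists_fst (x - a.1) (sub_ne_zero.2 (hx a ha).symm)
  have hc0' := (hri _ hc).1 hc0
  -- `z` is a unit which has no approximation by infinitesimals
  set z := (x - a.1) / c.1 with hz
  have hz0 : mk z = 0 := by
    rw [hz, div_eq_mul_inv, mk_mul, ← hca, ← mk_mul, mul_inv_cancel₀ hc0.ne', mk_one]
  have hxz : x = a.1 + c.1 * z := by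
    rw [hz]
    field_simp
    ring
  have hdist (p) (hp : p ∈ R) : ∃ n : ℕ, 1 ≤ n * |z - p.1| := by
    have h1 := hmax (a + c * p) (R.add_mem ha (R.mul_mem hc hp))
    have h2 : x - (a + c * p).1 = c.1 * (z - p.1) := by
      rw [hxz]
      simp only [Prod.fst_add, Prod.fst_mul]
      ring
    rw [h2, ← hca] at h1
    obtain ⟨n, hn⟩ := exists_abs_le_of_mk_le h1
    refine ⟨n, ?_⟩
    rw [abs_mul, abs_of_pos hc0] at hn
    nlinarith
  obtain ⟨r, hr⟩ := exists_real_of_mk_nonneg hz0.ge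
  obtain ⟨w, hw⟩ := hL.exists_real r
  -- Since z - p ≥ 1 / n, rationals enclosing r at distance less than 1 / (n + 1) provide one
  -- strictly between p and z, and R contains it.
  have hlt (p) (hp : p ∈ R) (hpz : p.1 < z) : p.2 < w := by
    obtain ⟨n, hn⟩ := hdist p hp
    rw [abs_of_pos (sub_pos.2 hpz)] at hn
    obtain ⟨q, q', hq2, hq1', h1⟩ := exists_rat_btwn_close r n
    have h2 : (q' : K) < q + 1 / (n + 1) := by
      have := (Rat.cast_lt (K := K)).2 h1
      push_cast at this
      exact this
    have h3 : z < q' := (hr q').2 hq1'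
    have h4 : p.1 < q := by
      rcases le_or_gt ((1 : K) / (n + 1)) (z - p.1) with h5 | h5
      · linarith
      · rw [lt_div_iff₀ (by positivity)] at h5
        linarith [sub_pos.2 hpz]
    exact ((hri.lt_iff hp (hR.ratCast_mem q)).1 h4).trans ((hw q).1 hq2)
  have hgt (p) (hp : p ∈ R) (hpz : z < p.1) : w < p.2 := by
    obtain ⟨n, hn⟩ := hdist p hp
    rw [abs_of_neg (sub_neg.2 hpz)] at hn
    obtain ⟨q, q', hq2, hq1', h1⟩ := exists_rat_btwn_close r n
    have h2 : (q' : K) < q + 1 / (n + 1) := by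
      have := (Rat.cast_lt (K := K)).2 h1
      push_cast at this
      exact this
    have h3 : q < z := (hr q).1 hq2
    have h4 : q' < p.1 := by
      rcases le_or_gt ((1 : K) / (n + 1)) (p.1 - z) with h5 | h5
      · linarith
      · rw [lt_div_iff₀ (by positivity)] at h5
        linarith [sub_pos.2 hpz]
    exact ((hw q').2 hq1').trans ((hri.lt_iff (hR.ratCast_mem q') hp).1 h4)
  have hmem (p) (hp : p ∈ R) : (p - a) * c⁻¹ ∈ R := R.mul_mem (R.sub_mem hp ha) (hR.inv_mem hc)
  refine ⟨a.2 + c.2 * w, sameCut_of_lt (fun p hp hpx ↦ ?_) (fun p hp hpx ↦ ?_) hx⟩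
  · have h1 := hlt _ (hmem p hp) (by
      simp only [Prod.fst_mul, Prod.fst_sub, Prod.fst_inv]
      rw [mul_inv_lt_iff₀ hc0]
      linarith)
    simp only [Prod.snd_mul, Prod.snd_sub, Prod.snd_inv] at h1
    rw [mul_inv_lt_iff₀ hc0'] at h1
    linarith
  · have h1 := hgt _ (hmem p hp) (by
      simp only [Prod.fst_mul, Prod.fst_sub, Prod.fst_inv]
      rw [lt_mul_inv_iff₀ hc0]
      linarith)
    simp only [Prod.snd_mul, Prod.snd_sub, Prod.snd_inv] at h1
    rw [lt_mul_inv_iff₀ hc0'] at h1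
    linarith

theorem IsMaximalPartialIso.exists_right (hR : IsMaximalPartialIso R) (hK : IsMaximallyValued K)
    (hL : IsMaximallyValued L) (x : K) : ∃ y, (x, y) ∈ R := by
  by_contra hx
  have hxne : ∀ p ∈ R, p.1 ≠ x := fun p hp h ↦ hx ⟨p.2, h ▸ hp⟩
  obtain ⟨y, hy⟩ := hR.exists_sameCut hL hxne
  exact hx ⟨y, hR.mem_of_sameCut hK.polynomialIVT hL.polynomialIVT hy hxne⟩

theorem IsPartialIso.exists_maximal (hR : IsPartialIso R)
    (h1 : ∀ x : K, x ≠ 0 → ∃ p ∈ R, 0 < p.1 ∧ mk p.1 = mk x)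
    (h2 : ∀ y : L, y ≠ 0 → ∃ p ∈ R, 0 < p.2 ∧ mk p.2 = mk y) :
    ∃ R', R ≤ R' ∧ IsMaximalPartialIso R' := by
  obtain ⟨R', hle, hmax⟩ := zorn_le_nonempty₀ {R : Subring (K × L) | IsPartialIso R}
    (fun c hc hchain S hS ↦ ⟨sSup c, fun p hp ↦ by
      obtain ⟨S', hS', hp⟩ := (Subring.mem_sSup_of_directedOn ⟨S, hS⟩ hchain.directedOn).1 hp
      exact hc hS' p hp, fun S' hS' ↦ le_sSup hS'⟩) R hR
  refine ⟨R', hle, hmax.prop, fun S hS hS' ↦ hmax.le_of_ge hS' hS, fun x hx ↦ ?_, fun y hy ↦ ?_⟩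
  · obtain ⟨p, hp, h⟩ := h1 x hx
    exact ⟨p, hle hp, h⟩
  · obtain ⟨p, hp, h⟩ := h2 y hy
    exact ⟨p, hle hp, h⟩

/-- A maximal partial isomorphism of maximally valued fields is an isomorphism. -/
theorem IsMaximalPartialIso.exists_orderRingIso (hR : IsMaximalPartialIso R)
    (hK : IsMaximallyValued K) (hL : IsMaximallyValued L) :
    ∃ e : K ≃+*o L, ∀ x, (x, e x) ∈ R := by
  let e₁ : R ≃+* K := RingEquiv.ofBijective ((RingHom.fst K L).comp R.subtype)
    ⟨hR.isPartialIso.fst_injective, fun x ↦ by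
      obtain ⟨y, hy⟩ := hR.exists_right hK hL x
      exact ⟨⟨_, hy⟩, rfl⟩⟩
  let e₂ : R ≃+* L := RingEquiv.ofBijective ((RingHom.snd K L).comp R.subtype)
    ⟨hR.isPartialIso.snd_injective, fun y ↦ by
      obtain ⟨x, hx⟩ := hR.swap.exists_right hL hK y
      exact ⟨⟨_, hx⟩, rfl⟩⟩
  have hmem (x : K) : (x, e₂ (e₁.symm x)) ∈ R := by
    have h1 : ((e₁.symm x : R) : K × L) = (x, e₂ (e₁.symm x)) := by
      ext
      · exact e₁.apply_symm_apply x
      · rfl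
    rw [← h1]
    exact (e₁.symm x).2
  exact ⟨⟨e₁.symm.trans e₂, fun {a b} ↦ (hR.isPartialIso.le_iff (hmem a) (hmem b)).symm⟩, hmem⟩

/-- Two groups of representatives for the archimedean classes, indexed by the same ordered group,
generate isomorphic ordered subrings. -/
theorem exists_isPartialIso {Γ : Type*} [AddCommGroup Γ] [LinearOrder Γ]
    (s : Multiplicative Γ →* K) (t : Multiplicative Γ →* L)
    (hs : ∀ γ, 0 < s γ) (ht : ∀ γ, 0 < t γ)
    (hsm : StrictMono fun γ : Γ ↦ mk (s (.ofAdd γ)))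
    (htm : StrictMono fun γ : Γ ↦ mk (t (.ofAdd γ))) :
    ∃ R : Subring (K × L), IsPartialIso R ∧ ∀ γ, (s γ, t γ) ∈ R := by
  -- The ring is the image of the group ring ℤ[Γ]. In both fields the sign of an image is that of
  -- the integer coefficient at the least exponent.
  let φ := (AddMonoidAlgebra.lift ℤ (K × L) Γ (s.prod t)).toRingHom
  refine ⟨φ.range, ?_, fun γ ↦ ⟨AddMonoidAlgebra.single γ.toAdd 1, ?_⟩⟩
  · rintro _ ⟨f, rfl⟩
    by_cases hf : f = 0
    · simp [hf]
    have hφ : φ f = f.coeff.sum fun γ n ↦ n • ((s (.ofAdd γ), t (.ofAdd γ)) : K × L) :=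
      AddMonoidAlgebra.lift_apply _ _
    have h1 : (φ f).1 = f.coeff.sum fun γ n ↦ (n : K) * s (.ofAdd γ) := by
      rw [hφ, Finsupp.sum, Finsupp.sum, Prod.fst_sum]
      simp
    have h2 : (φ f).2 = f.coeff.sum fun γ n ↦ (n : L) * t (.ofAdd γ) := by
      rw [hφ, Finsupp.sum, Finsupp.sum, Prod.snd_sum]
      simp
    have hne : f.coeff.support.Nonempty := 
      Finsupp.support_nonempty_iff.2 fun h ↦ hf (AddMonoidAlgebra.ext h)
    have h0 := Finsupp.mem_support_iff.1 (f.coeff.support.min'_mem hne)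
    have hmin (γ : Γ) (hγ : f.coeff γ ≠ 0) : f.coeff.support.min' hne ≤ γ :=
      f.coeff.support.min'_le γ (Finsupp.mem_support_iff.2 hγ)
    rw [h1, h2, sum_pos_iff_of_strictMono (fun γ ↦ hs _) hsm h0 hmin,
      sum_pos_iff_of_strictMono (fun γ ↦ ht _) htm h0 hmin]
  · simp [φ, AddMonoidAlgebra.lift_single]

end PartialIso

/-! ### Residue field, value group and conclusion -/

section Main

variable {K : Type*} [Field K] [LinearOrder K] [IsStrictOrderedRing K]

/-- The residue field embeds in ℝ as an ordered field. An element realizing r is finite, and its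
standard part is r because no rational separates the two. -/
theorem nonempty_finiteResidueField_iso
    (h : ∀ r : ℝ, ∃ x : K, ∀ q : ℚ, ((q : ℝ) < r → (q : K) < x) ∧ (r < q → x < q)) :
    Nonempty (FiniteResidueField K ≃+*o ℝ) := by
  let f : FiniteResidueField K →+*o ℝ := Classical.ofNonempty
  have hinj : Function.Injective f := f.toRingHom.injective
  have hsurj : Function.Surjective f := by
    intro r
    obtain ⟨x, hx⟩ := h r
    obtain ⟨q, hq⟩ := exists_rat_lt r
    obtain ⟨q', hq'⟩ := exists_rat_gt r
    have hx0 : 0 ≤ mk x :=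
      (le_min (mk_ratCast_nonneg q) (mk_ratCast_nonneg q')).trans
        (min_le_mk_of_le_of_le ((hx q).1 hq).le ((hx q').2 hq').le)
    refine ⟨.mk (.mk x hx0), ?_⟩
    rw [← stdPart_of_mk_nonneg f hx0]
    rcases lt_trichotomy (stdPart x) r with hlt | heq | hlt
    · obtain ⟨p, hp, hpr⟩ := exists_rat_btwn hlt
      have := stdPart_monotoneOn (mk_ratCast_nonneg p) hx0 ((hx p).1 hpr).le
      rw [stdPart_ratCast] at this
      exact absurd hp this.not_gt
    · exact heq
    · obtain ⟨p, hp, hpr⟩ := exists_rat_btwn hlt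
      have := stdPart_monotoneOn hx0 (mk_ratCast_nonneg p) ((hx p).2 hp).le
      rw [stdPart_ratCast] at this
      exact absurd hpr this.not_gt
  refine ⟨⟨RingEquiv.ofBijective f.toRingHom ⟨hinj, hsurj⟩, fun {a b} ↦ ?_⟩⟩
  exact (f.monotone'.strictMono_of_injective hinj).le_iff_le

/-- The value of a nonzero element, as an element of the value group. -/
theorem exists_value {x : K} (hx : x ≠ 0) :
    ∃ γ : NaturalValueGroup K, (γ : ArchimedeanClass K) = mk x :=
  ⟨⟨mk x, mk x⁻¹, by rw [← mk_mul, mul_inv_cancel₀ hx, mk_one],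
    by rw [← mk_mul, inv_mul_cancel₀ hx, mk_one]⟩, rfl⟩

theorem exists_of_value (γ : NaturalValueGroup K) : ∃ x : K, x ≠ 0 ∧ mk x = γ := by
  obtain ⟨x, hx⟩ := mk_surjective (M := K) γ
  refine ⟨x, ?_, hx⟩
  rintro rfl
  have h1 : (γ : ArchimedeanClass K) + (-γ : NaturalValueGroup K) = 0 := AddUnits.add_neg γ
  rw [← hx, mk_zero, top_add] at h1
  exact top_ne_zero h1

theorem IsMaximallyValued.exists_nsmul_eq (h : IsMaximallyValued K) {n : ℕ} (hn : n ≠ 0)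
    (γ : NaturalValueGroup K) : ∃ δ, n • δ = γ := by
  obtain ⟨x, hx, hγ⟩ := exists_of_value γ
  obtain ⟨t, ht⟩ := h.exists_mk_pow n hn x
  have ht0 : t ≠ 0 := by
    rintro rfl
    rw [zero_pow hn, mk_zero, eq_comm, mk_eq_top_iff] at ht
    exact hx ht
  obtain ⟨δ, hδ⟩ := exists_value ht0
  refine ⟨δ, AddUnits.ext ?_⟩
  rw [AddUnits.val_nsmul_eq_nsmul_val, hδ, ← mk_pow, ht, hγ]

/-- The monomials with coefficient one. -/
noncomputable def hahnMonomial (Γ : Type*) [AddCommGroup Γ] [LinearOrder Γ]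
    [IsOrderedAddMonoid Γ] : Multiplicative Γ →* Lex (HahnSeries Γ ℝ) where
  toFun γ := toLex (HahnSeries.single γ.toAdd 1)
  map_one' := rfl
  map_mul' γ δ := by
    rw [← toLex_mul, HahnSeries.single_mul_single, one_mul, toAdd_mul]

end Main

theorem theorem9p8 (K : Type*) [Field K] [LinearOrder K] [IsStrictOrderedRing K]
    (hK : (orderBallSpace K).SphericallyComplete) :
    Nonempty (ArchimedeanClass.FiniteResidueField K ≃+*o ℝ) ∧
    ∃ e : K ≃+*o PowerSeriesField (NaturalValueGroup K) ℝ,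
      ∀ x : K, x ≠ 0 →
        ((ofLex (e x)).order : ArchimedeanClass K) = ArchimedeanClass.mk x := by
  have hKm := isMaximallyValued_of_sphericallyComplete hK
  refine ⟨nonempty_finiteResidueField_iso hKm.exists_real, ?_⟩
  have hLm : IsMaximallyValued (Lex (HahnSeries (NaturalValueGroup K) ℝ)) :=
    isMaximallyValued_hahnSeries fun n hn ↦ hKm.exists_nsmul_eq hn
  obtain ⟨s, hs⟩ := hKm.polynomialIVT.exists_crossSection
  let t := hahnMonomial (NaturalValueGroup K)
  have htop (γ : Multiplicative (NaturalValueGroup K)) :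
      (ofLex (t γ)).orderTop = (γ.toAdd : WithTop (NaturalValueGroup K)) :=
    HahnSeries.orderTop_single one_ne_zero
  have htpos (γ : Multiplicative (NaturalValueGroup K)) : 0 < t γ := by
    rw [← HahnSeries.leadingCoeff_pos_iff]
    exact one_pos.trans_eq HahnSeries.leadingCoeff_of_single.symm
  obtain ⟨R₀, hR₀, hst⟩ := exists_isPartialIso s t (fun γ ↦ (hs γ).1)
    htpos
    (fun γ δ h ↦ by simpa [hs] using h)
    (fun γ δ h ↦ by
      rw [lt_iff_not_ge, mk_le_mk_iff_orderTop, htop, htop, WithTop.coe_le_coe]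
      exact h.not_ge)
  obtain ⟨R, hle, hR⟩ := hR₀.exists_maximal (fun x hx ↦ by
      obtain ⟨γ, hγ⟩ := exists_value hx
      exact ⟨_, hst (.ofAdd γ), (hs _).1, (hs _).2.trans hγ⟩) (fun y hy ↦ by
      let γ := (ofLex y).orderTop.untop (HahnSeries.orderTop_ne_top.2 hy)
      refine ⟨_, hst (.ofAdd γ), htpos _, ?_⟩
      rw [mk_eq_mk_iff_orderTop, htop, toAdd_ofAdd, WithTop.coe_untop])
  obtain ⟨e, he⟩ := hR.exists_orderRingIso hKm hLm
  refine ⟨e, fun x hx ↦ ?_⟩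
  obtain ⟨γ, hγ⟩ := exists_value hx
  -- Both (x, e x) and (s γ, t γ) lie in R, which preserves comparison of classes, so e x has the
  -- order γ of the monomial t γ.
  have h1 : mk x = mk (s (.ofAdd γ)) := hγ.symm.trans (hs _).2.symm
  have h2 : mk (e x) = mk (t (.ofAdd γ)) := le_antisymm
    ((hR.isPartialIso.mk_le_mk_iff (he x) (hle (hst _))).1 h1.le)
    ((hR.isPartialIso.mk_le_mk_iff (hle (hst _)) (he x)).1 h1.ge)
  rw [mk_eq_mk_iff_orderTop, htop] at h2
  rw [← hγ]
  congr 1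
  have h3 : ofLex (e x) ≠ 0 := by simpa using hx
  rw [← HahnSeries.order_eq_orderTop_of_ne_zero h3] at h2
  exact WithTop.coe_injective h2
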